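/- For integers $p,q\ge 1$ and signs $\sigma_1,\sigma_2\in\{1,-1\}$ with $(p,\sigma_1)\neq(1,1)$, let $$t(p,q;\sigma_1,\sigma_2)=\sum_{n_1>n_2\ge 1}\frac{\sigma_1^{n_1}\sigma_2^{n_2}}{(2n_1-1)^{p}(2n_2-1)^{q}},\qquad \tilde t(p,q;\sigma_1,\sigma_2)=\sum_{n_1>n_2\ge 1}\frac{\sigma_1^{n_1}\sigma_2^{n_2}}{(n_1-\frac12)^{p}(n_2-\frac12)^{q}},$$ where each double series is understood as the limit, as $N\to\infty$, of its partial sums over $N\ge n_1>n_2\ge 1$. Let $\zeta$ be the Riemann zeta function, $\beta(s)=\sum_{n\ge 0}(-1)^n(2n+1)^{-s}$ the Dirichlet beta function, and $G=\beta(2)$ Catalan's constant. If the integers $p+q$ and $\frac{1+\sigma_1\sigma_2}{2}$ have the same parity, then both series converge, and each of the values $t(p,q;\sigma_1,\sigma_2)$ and $\tilde t(p,q;\sigma_1,\sigma_2)$ is a polynomial with rational coefficients in finitely many of the numbers $\pi$, $\ln 2$, $G$, $\zeta(3),\zeta(5),\zeta(7),\ldots$ and $\beta(4),\beta(6),\beta(8),\ldots$.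 -/

import Mathlib

open Filter Topology

noncomputable section

/-- Partial sum, over `N ≥ n₁ > n₂ ≥ 1`, of the series defining the double `t`-value
`t(p, q; σ₁, σ₂)`. The group `ℤˣ` is exactly `{1, -1}`. -/
def doubleTPartial (p q : ℕ) (σ₁ σ₂ : ℤˣ) (N : ℕ) : ℝ :=
  ∑ n₁ ∈ Finset.Icc 1 N, ∑ n₂ ∈ Finset.Ico 1 n₁,
    (((σ₁ : ℤ) : ℝ) ^ n₁ * ((σ₂ : ℤ) : ℝ) ^ n₂) /
      ((2 * (n₁ : ℝ) - 1) ^ p * (2 * (n₂ : ℝ) - 1) ^ q)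

/-- The double `t`-value `t(p, q; σ₁, σ₂)`: the sum of the (possibly only conditionally
convergent) series, i.e. the limit of its partial sums. -/
def doubleT (p q : ℕ) (σ₁ σ₂ : ℤˣ) : ℝ :=
  limUnder atTop (doubleTPartial p q σ₁ σ₂)

/-- Partial sum, over `N ≥ n₁ > n₂ ≥ 1`, of the series defining the normalized double
`t`-value `t̃(p, q; σ₁, σ₂)`. -/
def doubleTTildePartial (p q : ℕ) (σ₁ σ₂ : ℤˣ) (N : ℕ) : ℝ :=
  ∑ n₁ ∈ Finset.Icc 1 N, ∑ n₂ ∈ Finset.Ico 1 n₁,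
    (((σ₁ : ℤ) : ℝ) ^ n₁ * ((σ₂ : ℤ) : ℝ) ^ n₂) /
      (((n₁ : ℝ) - 1 / 2) ^ p * ((n₂ : ℝ) - 1 / 2) ^ q)

/-- The normalized double `t`-value `t̃(p, q; σ₁, σ₂)`. -/
def doubleTTilde (p q : ℕ) (σ₁ σ₂ : ℤˣ) : ℝ :=
  limUnder atTop (doubleTTildePartial p q σ₁ σ₂)

/-- The Dirichlet beta value `β(s) = ∑_{n ≥ 0} (-1)ⁿ / (2n+1)ˢ`; it is used only for `s ≥ 2`,
where the series converges absolutely. -/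
def dirichletBeta (s : ℕ) : ℝ :=
  ∑' n : ℕ, (-1 : ℝ) ^ n / (2 * (n : ℝ) + 1) ^ s

/-- Catalan's constant `G = β(2)`. -/
def catalanG : ℝ := dirichletBeta 2

/-- The constants `π`, `ln 2`, `G`, the odd zeta values `ζ(3), ζ(5), …` and the Dirichlet beta
values `β(4), β(6), …`. -/
def parityConstants : Set ℝ :=
  {Real.pi, Real.log 2, catalanG} ∪
    {x : ℝ | ∃ k : ℕ, 1 ≤ k ∧ (x : ℂ) = riemannZeta (2 * (k : ℂ) + 1)} ∪
    {x : ℝ | ∃ k : ℕ, 2 ≤ k ∧ x = dirichletBeta (2 * k)}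

/-- `x` is a combination of the constants above, i.e. a polynomial in (finitely many of) them with
rational coefficients. -/
def IsReducible (x : ℝ) : Prop :=
  x ∈ Algebra.adjoin ℚ parityConstants

end

/-! Up to sign, each double series is `∑ f i * ∑_{j<i} g j`, where `f` and `g` have the form `sⁱ /
(2i+1)ᵖ` with `s = ±1`. Extended to all integers `i`, such a term is even or odd in `2i+1` up to
sign (`EvenSign`, `OddSign`), and the parity condition says that `f` and `g` fall in opposite
classes.

Suppose `f` is odd with exponent at least 2 and `g` is even. Then `∑ f i sin((2i+1)x)` is a
polynomial `P(x)` on `[0, π/2]`, by the Fourier series of Bernoulli polynomials, and `g i = ∫ Q(x)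
cos((2i+1)x)` over `[0, π/2]` for a polynomial `Q`. Summing cosines gives `g i + 2 ∑_{j<i} g j = ∫
Q(x) sin((2i+1)x) cot x`, so summation against `f` produces `∫ Q P cot x` with `P(0) = 0`. Expanding
`cot x` as `2 ∑ sin 2kx` and integrating by parts expresses this through `π`, `log 2` and odd zeta
values (`integral_aeval_mul_cot_mem_parityRing`). The diagonal `∑ f i * g i` is a single series of
the odd class, hence comes from an odd zeta or an even beta value. This is
`seriesIn_mul_sum_of_cos_moments`.

If `f` is even and `g` is odd, the product of the two single series exchanges the roles, unless `g i
= 1/(2i+1)`, whose series diverges. Then the kernel `(1 - cos x cos((2i+1)x)) / sin x` gives the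
inner sum, and the extra integral of `(1 - cos x) / sin x` contributes `log 2`
(`seriesIn_mul_sum_one_div_odd`). When both exponents are 1, termwise integration fails, and partial
sums are handled by dominated convergence (`seriesIn_alternating_mul_sum_one_div_odd`). -/

/-- The ring of polynomials with rational coefficients in the constants `parityConstants`. -/
noncomputable def parityRing : Subalgebra ℚ ℝ := Algebra.adjoin ℚ parityConstants

theorem ratCast_mem_parityRing (r : ℚ) : (r : ℝ) ∈ parityRing :=
  parityRing.algebraMap_mem r

theorem natCast_mem_parityRing (n : ℕ) : (n : ℝ) ∈ parityRing := natCast_mem parityRing n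

theorem div_natCast_mem_parityRing {x : ℝ} (hx : x ∈ parityRing) (n : ℕ) :
    x / n ∈ parityRing := by
  have h := parityRing.mul_mem hx (ratCast_mem_parityRing (1 / (n : ℚ)))
  have e : x * ((1 / (n : ℚ) : ℚ) : ℝ) = x / n := by push_cast; ring
  rwa [e] at h

theorem div_pow_natCast_mem_parityRing {x : ℝ} (hx : x ∈ parityRing) (n k : ℕ) :
    x / (n : ℝ) ^ k ∈ parityRing := by
  have h := div_natCast_mem_parityRing hx (n ^ k)
  rwa [Nat.cast_pow] at h

theorem pi_mem_parityRing : Real.pi ∈ parityRing :=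
  Algebra.subset_adjoin (Or.inl (Or.inl (by simp)))

theorem pi_div_two_mem_parityRing : Real.pi / 2 ∈ parityRing := by
  simpa using div_natCast_mem_parityRing pi_mem_parityRing 2

theorem log_two_mem_parityRing : Real.log 2 ∈ parityRing :=
  Algebra.subset_adjoin (Or.inl (Or.inl (by simp)))

theorem dirichletBeta_mem_parityRing {k : ℕ} (hk : 1 ≤ k) :
    dirichletBeta (2 * k) ∈ parityRing := by
  rcases hk.eq_or_lt with rfl | hk
  · exact Algebra.subset_adjoin (Or.inl (Or.inl (by simp [catalanG])))
  · exact Algebra.subset_adjoin (Or.inr ⟨k, hk, rfl⟩)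

theorem tsum_one_div_pow_odd_mem_parityRing {k : ℕ} (hk : 1 ≤ k) :
    ∑' n : ℕ, 1 / (n : ℝ) ^ (2 * k + 1) ∈ parityRing := by
  refine Algebra.subset_adjoin (Or.inl (Or.inr ⟨k, hk, ?_⟩))
  have h := zeta_nat_eq_tsum_of_gt_one (k := 2 * k + 1) (by lia)
  push_cast at h ⊢
  exact h.symm

/-! ### Single series with sum in the ring -/

/-- The partial sums of `u` converge to an element of `parityRing`. -/
def SeriesIn (u : ℕ → ℝ) : Prop :=
  ∃ L ∈ parityRing, Tendsto (fun N => ∑ i ∈ Finset.range N, u i) atTop (𝓝 L)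

theorem HasSum.seriesIn {u : ℕ → ℝ} {L : ℝ} (h : HasSum u L) (hL : L ∈ parityRing) :
    SeriesIn u := ⟨L, hL, h.tendsto_sum_nat⟩

theorem SeriesIn.add {u v : ℕ → ℝ} (hu : SeriesIn u) (hv : SeriesIn v) :
    SeriesIn (fun i => u i + v i) := by
  obtain ⟨L, hL, h⟩ := hu
  obtain ⟨M, hM, h'⟩ := hv
  refine ⟨L + M, add_mem hL hM, ?_⟩
  simpa only [Finset.sum_add_distrib] using h.add h'

theorem SeriesIn.const_mul {u : ℕ → ℝ} {c : ℝ} (hc : c ∈ parityRing) (hu : SeriesIn u) :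
    SeriesIn (fun i => c * u i) := by
  obtain ⟨L, hL, h⟩ := hu
  refine ⟨c * L, mul_mem hc hL, ?_⟩
  simpa only [Finset.mul_sum] using h.const_mul c

theorem SeriesIn.congr {u v : ℕ → ℝ} (hu : SeriesIn u) (h : ∀ i, v i = u i) : SeriesIn v := by
  rwa [funext h]

theorem HasSum.odd_of_even {g : ℕ → ℝ} {S E : ℝ} (hS : HasSum g S)
    (hE : HasSum (fun n => g (2 * n)) E) : HasSum (fun n => g (2 * n + 1)) (S - E) := by
  have ho : Summable fun n => g (2 * n + 1) :=
    hS.summable.comp_injective (i := fun n => 2 * n + 1) (fun a b h => by simpa using h)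
  have h := hS.unique (hE.even_add_odd ho.hasSum)
  rw [h, add_sub_cancel_left]
  exact ho.hasSum

theorem hasSum_one_div_pow_even {k : ℕ} {S : ℝ} (h : HasSum (fun n : ℕ => 1 / (n : ℝ) ^ k) S) :
    HasSum (fun n : ℕ => 1 / ((2 * n : ℕ) : ℝ) ^ k) (S / (2 : ℕ) ^ k) := by
  refine (h.div_const _).congr_fun ?_
  intro n
  push_cast
  rw [mul_pow, div_div, mul_comm]

theorem seriesIn_one_div_succ_pow {k : ℕ} (hk : 1 ≤ k) :
    SeriesIn (fun i => 1 / ((i : ℝ) + 1) ^ (2 * k + 1)) := by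
  have h : HasSum (fun n : ℕ => 1 / (n : ℝ) ^ (2 * k + 1)) _ :=
    (Real.summable_one_div_nat_pow.2 (by lia)).hasSum
  refine HasSum.seriesIn (L := ∑' n : ℕ, 1 / (n : ℝ) ^ (2 * k + 1)) ?_
    (tsum_one_div_pow_odd_mem_parityRing hk)
  -- Dropping the term `n = 0` costs nothing, since it is `1 / 0 = 0`.
  simpa using (hasSum_nat_add_iff' 1).2 h

theorem seriesIn_one_div_odd_pow {k : ℕ} (hk : 1 ≤ k) :
    SeriesIn (fun i => 1 / (2 * (i : ℝ) + 1) ^ (2 * k + 1)) := by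
  have h : HasSum (fun n : ℕ => 1 / (n : ℝ) ^ (2 * k + 1)) _ :=
    (Real.summable_one_div_nat_pow.2 (by lia)).hasSum
  have hm := tsum_one_div_pow_odd_mem_parityRing hk
  refine HasSum.seriesIn ?_ (sub_mem hm (div_pow_natCast_mem_parityRing hm 2 (2 * k + 1)))
  simpa using h.odd_of_even (hasSum_one_div_pow_even h)

theorem seriesIn_neg_one_pow_div_odd_pow {k : ℕ} (hk : 1 ≤ k) :
    SeriesIn (fun i => (-1 : ℝ) ^ i / (2 * (i : ℝ) + 1) ^ (2 * k)) := by
  refine HasSum.seriesIn ?_ (dirichletBeta_mem_parityRing hk)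
  refine Summable.hasSum (Summable.of_norm ?_)
  have h : Summable fun i : ℕ => 1 / ((2 * i + 1 : ℕ) : ℝ) ^ (2 * k) :=
    (Real.summable_one_div_nat_pow (p := 2 * k).2 (by lia)).comp_injective
      (i := fun n => 2 * n + 1) (fun a b h => by simpa using h)
  refine h.congr fun i => ?_
  rw [norm_div, norm_pow, norm_pow]
  simp [abs_of_nonneg (by positivity : (0 : ℝ) ≤ 2 * i + 1)]

/-- Leibniz's criterion gives convergence; Abel's limit theorem identifies the sum as the limit of
`log (1 + x) / x` as `x → 1⁻`. -/
theorem tendsto_alternating_harmonic :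
    Tendsto (fun N => ∑ i ∈ Finset.range N, (-1 : ℝ) ^ i / ((i : ℝ) + 1)) atTop
      (𝓝 (Real.log 2)) := by
  have ha : Antitone fun i : ℕ => 1 / ((i : ℝ) + 1) := fun m n h => by
    dsimp only; gcongr
  obtain ⟨l, hl⟩ := ha.tendsto_alternating_series_of_tendsto_zero
    tendsto_one_div_add_atTop_nhds_zero_nat
  have hl' : Tendsto (fun N => ∑ i ∈ Finset.range N, (-1 : ℝ) ^ i / ((i : ℝ) + 1)) atTop
      (𝓝 l) := by simpa [div_eq_mul_inv] using hl
  have habel := Real.tendsto_tsum_powerSeries_nhdsWithin_lt hl'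
  have hlog : Tendsto (fun x : ℝ => Real.log (1 + x) / x) (𝓝[<] 1) (𝓝 (Real.log (1 + 1) / 1)) := by
    refine Tendsto.mono_left ?_ nhdsWithin_le_nhds
    exact ((continuousAt_const.add continuousAt_id).log (by norm_num)).div continuousAt_id
      one_ne_zero
  have he : (fun x : ℝ => ∑' n : ℕ, (-1 : ℝ) ^ n / ((n : ℝ) + 1) * x ^ n) =ᶠ[𝓝[<] 1]
      fun x => Real.log (1 + x) / x := by
    filter_upwards [Ioo_mem_nhdsLT (show (0 : ℝ) < 1 by norm_num)] with x hx
    have h := Real.hasSum_pow_div_log_of_abs_lt_one (x := -x)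
      (by rw [abs_neg, abs_of_pos hx.1]; exact hx.2)
    rw [sub_neg_eq_add] at h
    rw [((h.neg.div_const x).congr_fun fun n => ?_).tsum_eq, neg_neg]
    have := hx.1.ne'
    rw [pow_succ, neg_pow x]
    field_simp
  have h := tendsto_nhds_unique (habel.congr' he) hlog
  rw [h] at hl'
  norm_num at hl'
  exact hl'

theorem seriesIn_neg_one_pow_div_succ_pow (k : ℕ) :
    SeriesIn (fun i => (-1 : ℝ) ^ i / ((i : ℝ) + 1) ^ (2 * k + 1)) := by
  rcases Nat.eq_zero_or_pos k with rfl | hk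
  · exact ⟨_, log_two_mem_parityRing, by simpa using tendsto_alternating_harmonic⟩
  have h : HasSum (fun n : ℕ => 1 / (n : ℝ) ^ (2 * k + 1)) _ :=
    (Real.summable_one_div_nat_pow.2 (by lia)).hasSum
  have hm := tsum_one_div_pow_odd_mem_parityRing hk
  have hE := hasSum_one_div_pow_even h
  have hO := h.odd_of_even hE
  have hEm := div_pow_natCast_mem_parityRing hm 2 (2 * k + 1)
  have hA := HasSum.even_add_odd (f := fun n : ℕ => -(-1 : ℝ) ^ n / (n : ℝ) ^ (2 * k + 1))
    (hE.neg.congr_fun fun n => by simp [neg_div]) (hO.congr_fun fun n => by simp [pow_succ])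
  refine HasSum.seriesIn ?_ (add_mem (neg_mem hEm) (sub_mem hm hEm))
  simpa [pow_succ _ 1, pow_succ (-1 : ℝ)] using (hasSum_nat_add_iff' 1).2 hA

/-! ### The Riemann–Lebesgue lemma -/

theorem tendsto_integral_mul_cos_sin_two_mul {g : ℝ → ℝ} {b : ℝ} (hb : 0 ≤ b)
    (hg : IntervalIntegrable g MeasureTheory.volume 0 b) :
    Tendsto (fun N : ℕ => ∫ x in (0 : ℝ)..b, g x * Real.cos (2 * N * x)) atTop (𝓝 0) ∧
    Tendsto (fun N : ℕ => ∫ x in (0 : ℝ)..b, g x * Real.sin (2 * N * x)) atTop (𝓝 0) := by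
  have h := Real.tendsto_integral_exp_smul_cocompact
    (Set.indicator (Set.Ioc 0 b) (fun x => (g x : ℂ)))
  -- The character is `v ↦ exp(-2πi v w)`, so `w = N / π` gives the frequency `2N`.
  have ht : Tendsto (fun N : ℕ => (N : ℝ) / Real.pi) atTop (cocompact ℝ) :=
    (tendsto_natCast_atTop_atTop.atTop_div_const Real.pi_pos).mono_right atTop_le_cocompact
  have h1 := h.comp ht
  have hgi : MeasureTheory.IntegrableOn g (Set.Ioc 0 b) :=
    (intervalIntegrable_iff_integrableOn_Ioc_of_le hb).1 hg
  have key : ∀ N : ℕ, ∫ v : ℝ, Real.fourierChar (-(v * ((N : ℝ) / Real.pi))) •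
      Set.indicator (Set.Ioc 0 b) (fun x => (g x : ℂ)) v =
      (((∫ x in (0 : ℝ)..b, g x * Real.cos (2 * N * x) : ℝ) : ℂ)) -
        ((∫ x in (0 : ℝ)..b, g x * Real.sin (2 * N * x) : ℝ) : ℂ) * Complex.I := by
    intro N
    have hc : IntervalIntegrable (fun x => ((g x * Real.cos (2 * N * x) : ℝ) : ℂ))
        MeasureTheory.volume 0 b := by
      have h := hg.mul_continuousOn (g := fun x => Real.cos (2 * N * x)) (by fun_prop)
      exact ⟨h.1.ofReal, h.2.ofReal⟩
    have hs : IntervalIntegrable (fun x => ((g x * Real.sin (2 * N * x) : ℝ) : ℂ))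
        MeasureTheory.volume 0 b := by
      have h := hg.mul_continuousOn (g := fun x => Real.sin (2 * N * x)) (by fun_prop)
      exact ⟨h.1.ofReal, h.2.ofReal⟩
    rw [← intervalIntegral.integral_ofReal, ← intervalIntegral.integral_ofReal,
      ← intervalIntegral.integral_mul_const, ← intervalIntegral.integral_sub hc (hs.mul_const _), intervalIntegral.integral_of_le hb,
      ← MeasureTheory.integral_indicator measurableSet_Ioc]
    congr 1
    ext v
    by_cases hv : v ∈ Set.Ioc 0 b
    · simp only [Set.indicator_of_mem hv, Circle.smul_def, Real.fourierChar_apply, smul_eq_mul]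
      have : ((2 * Real.pi * -(v * (N / Real.pi)) : ℝ) : ℂ) * Complex.I =
          ((-(2 * N * v) : ℝ) : ℂ) * Complex.I := by
        congr 2
        field_simp
      rw [this, Complex.exp_mul_I, ← Complex.ofReal_cos, ← Complex.ofReal_sin, Real.cos_neg,
        Real.sin_neg]
      push_cast
      ring
    · simp [Set.indicator_of_notMem hv]
  have h2 : Tendsto (fun N : ℕ =>
      (((∫ x in (0 : ℝ)..b, g x * Real.cos (2 * N * x) : ℝ) : ℂ)) -
        ((∫ x in (0 : ℝ)..b, g x * Real.sin (2 * N * x) : ℝ) : ℂ) * Complex.I) atTop (𝓝 0) :=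
    h1.congr key
  constructor
  · simpa [Function.comp_def] using (Complex.continuous_re.tendsto _).comp h2
  · simpa [Function.comp_def] using ((Complex.continuous_im.tendsto _).comp h2).neg

/-! ### Polynomials over the ring and their trigonometric moments on `[0, π/2]` -/

open Polynomial in
theorem Polynomial.exists_derivative_eq {A : Type*} [CommRing A] [Algebra ℚ A] (P : A[X]) :
    ∃ Q : A[X], derivative Q = P := by
  induction P using Polynomial.induction_on' with
  | add p q hp hq =>
    obtain ⟨a, rfl⟩ := hp
    obtain ⟨b, rfl⟩ := hq
    exact ⟨a + b, derivative_add⟩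
  | monomial n a =>
    refine ⟨monomial (n + 1) ((1 / ((n : ℚ) + 1)) • a), ?_⟩
    have h : (1 / ((n : ℚ) + 1)) * ((n : ℚ) + 1) = 1 := by
      field_simp
    rw [derivative_monomial, Nat.add_sub_cancel]
    congr 1
    have e : ((n + 1 : ℕ) : A) = algebraMap ℚ A ((n : ℚ) + 1) := by simp
    rw [e, mul_comm, ← Algebra.smul_def, smul_smul, mul_comm, h, one_smul]

theorem aeval_mem_parityRing (P : Polynomial parityRing) {x : ℝ} (hx : x ∈ parityRing) :
    Polynomial.aeval x P ∈ parityRing := by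
  have h : Polynomial.aeval (algebraMap parityRing ℝ ⟨x, hx⟩) P =
      algebraMap parityRing ℝ (Polynomial.aeval (⟨x, hx⟩ : parityRing) P) :=
    Polynomial.aeval_algebraMap_apply _ _ _
  have h' : Polynomial.aeval x P = algebraMap parityRing ℝ _ := h
  rw [h']
  exact (Polynomial.aeval (⟨x, hx⟩ : parityRing) P).2

theorem integral_aeval_mul_cos (P : Polynomial parityRing) {b : ℝ} (hb : b ≠ 0) (c : ℝ) :
    ∫ x in (0 : ℝ)..c, Polynomial.aeval x P * Real.cos (b * x) =
      Polynomial.aeval c P * Real.sin (b * c) / b -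
        (∫ x in (0 : ℝ)..c, Polynomial.aeval x (Polynomial.derivative P) * Real.sin (b * x)) / b := by
  have h := intervalIntegral.integral_mul_deriv_eq_deriv_mul (a := 0) (b := c)
    (u := fun x => Polynomial.aeval x P)
    (u' := fun x => Polynomial.aeval x (Polynomial.derivative P))
    (v := fun x => Real.sin (b * x) / b) (v' := fun x => Real.cos (b * x))
    (fun x _ => P.hasDerivAt_aeval x)
    (fun x _ => by
      have := (((hasDerivAt_id x).const_mul b).sin).div_const b
      simpa [hb] using this)
    (Continuous.intervalIntegrable (by fun_prop) _ _)
    (Continuous.intervalIntegrable (by fun_prop) _ _)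
  rw [h, ← intervalIntegral.integral_div]
  simp [mul_div_assoc]

theorem integral_aeval_mul_sin (P : Polynomial parityRing) {b : ℝ} (hb : b ≠ 0) (c : ℝ) :
    ∫ x in (0 : ℝ)..c, Polynomial.aeval x P * Real.sin (b * x) =
      (Polynomial.aeval (0 : ℝ) P - Polynomial.aeval c P * Real.cos (b * c)) / b +
        (∫ x in (0 : ℝ)..c, Polynomial.aeval x (Polynomial.derivative P) * Real.cos (b * x)) / b := by
  have h := intervalIntegral.integral_mul_deriv_eq_deriv_mul (a := 0) (b := c)
    (u := fun x => Polynomial.aeval x P)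
    (u' := fun x => Polynomial.aeval x (Polynomial.derivative P))
    (v := fun x => -(Real.cos (b * x) / b)) (v' := fun x => Real.sin (b * x))
    (fun x _ => P.hasDerivAt_aeval x)
    (fun x _ => by
      have := ((((hasDerivAt_id x).const_mul b).cos).div_const b).fun_neg
      simpa [hb, neg_div] using this)
    (Continuous.intervalIntegrable (by fun_prop) _ _)
    (Continuous.intervalIntegrable (by fun_prop) _ _)
  rw [h, ← intervalIntegral.integral_div]
  simp only [mul_neg, intervalIntegral.integral_neg, mul_zero, Real.cos_zero, mul_div_assoc]
  ring

theorem cos_odd_mul_pi_div_two (i : ℕ) : Real.cos ((2 * (i : ℝ) + 1) * (Real.pi / 2)) = 0 := by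
  rw [show (2 * (i : ℝ) + 1) * (Real.pi / 2) = Real.pi / 2 + i * Real.pi by ring,
    Real.cos_add_nat_mul_pi]
  simp

theorem sin_odd_mul_pi_div_two (i : ℕ) :
    Real.sin ((2 * (i : ℝ) + 1) * (Real.pi / 2)) = (-1) ^ i := by
  rw [show (2 * (i : ℝ) + 1) * (Real.pi / 2) = Real.pi / 2 + i * Real.pi by ring,
    Real.sin_add_nat_mul_pi]
  simp

/-- Two integrations by parts divide the moments by `(2i+1)²`, provided that no boundary term
survives. The constants of integration are chosen so that the new polynomial vanishes at `π/2` and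
its derivative at `0`; the remaining terms contain `cos((2i+1)π/2) = 0` or `sin 0 = 0`. -/
theorem exists_cos_moments_step {f : ℕ → ℝ} (h : ∃ P : Polynomial parityRing, ∀ i : ℕ,
      ∫ x in (0 : ℝ)..(Real.pi / 2), Polynomial.aeval x P * Real.cos ((2 * (i : ℝ) + 1) * x) = f i) :
    ∃ P : Polynomial parityRing, ∀ i : ℕ,
      ∫ x in (0 : ℝ)..(Real.pi / 2), Polynomial.aeval x P * Real.cos ((2 * (i : ℝ) + 1) * x) =
        f i / (2 * (i : ℝ) + 1) ^ 2 := by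
  obtain ⟨Q, hQ⟩ := h
  obtain ⟨U, hU⟩ := Polynomial.exists_derivative_eq (-Q)
  obtain ⟨V, hV⟩ := Polynomial.exists_derivative_eq (U - Polynomial.C (U.coeff 0))
  have hm := aeval_mem_parityRing V pi_div_two_mem_parityRing
  refine ⟨V - Polynomial.C ⟨_, hm⟩, fun i => ?_⟩
  have hb : (2 * (i : ℝ) + 1) ≠ 0 := by positivity
  have hz : Polynomial.aeval (0 : ℝ) (U - Polynomial.C (U.coeff 0)) = 0 := by
    rw [← Polynomial.coeff_zero_eq_aeval_zero']
    simp
  have hz' : Polynomial.aeval (Real.pi / 2) (V - Polynomial.C (⟨_, hm⟩ : parityRing)) = 0 := by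
    rw [map_sub, Polynomial.aeval_C]
    exact sub_self _
  rw [integral_aeval_mul_cos _ hb, Polynomial.derivative_sub, Polynomial.derivative_C, sub_zero,
    hV, integral_aeval_mul_sin _ hb, Polynomial.derivative_sub, Polynomial.derivative_C, sub_zero,
    hU, hz, hz', cos_odd_mul_pi_div_two, ← hQ i]
  simp only [map_neg, neg_mul, intervalIntegral.integral_neg]
  field_simp
  ring

theorem exists_cos_moments_even (k : ℕ) : ∃ P : Polynomial parityRing, ∀ i : ℕ,
    ∫ x in (0 : ℝ)..(Real.pi / 2), Polynomial.aeval x P * Real.cos ((2 * (i : ℝ) + 1) * x) =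
      1 / (2 * (i : ℝ) + 1) ^ (2 * (k + 1)) := by
  induction k with
  | zero =>
    -- The polynomial `π/2 - x` vanishes at `π/2` and has derivative `-1`.
    refine ⟨Polynomial.C ⟨_, pi_div_two_mem_parityRing⟩ - Polynomial.X, fun i => ?_⟩
    have hb : (2 * (i : ℝ) + 1) ≠ 0 := by positivity
    have hc : Polynomial.aeval (Real.pi / 2)
        (Polynomial.C (⟨_, pi_div_two_mem_parityRing⟩ : parityRing) - Polynomial.X) = 0 := by
      rw [map_sub, Polynomial.aeval_C, Polynomial.aeval_X]
      exact sub_self _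
    have hd : Polynomial.derivative
        (Polynomial.C (⟨_, pi_div_two_mem_parityRing⟩ : parityRing) - Polynomial.X) =
        Polynomial.C (-1) := by simp
    rw [integral_aeval_mul_cos _ hb, hc, hd, integral_aeval_mul_sin _ hb, Polynomial.derivative_C,
      cos_odd_mul_pi_div_two]
    simp
    field_simp
  | succ k ih =>
    obtain ⟨P, hP⟩ := exists_cos_moments_step ih
    refine ⟨P, fun i => (hP i).trans ?_⟩
    rw [div_div, ← pow_add]
    rfl

theorem exists_cos_moments_odd (k : ℕ) : ∃ P : Polynomial parityRing, ∀ i : ℕ,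
    ∫ x in (0 : ℝ)..(Real.pi / 2), Polynomial.aeval x P * Real.cos ((2 * (i : ℝ) + 1) * x) =
      (-1) ^ i / (2 * (i : ℝ) + 1) ^ (2 * k + 1) := by
  induction k with
  | zero =>
    refine ⟨1, fun i => ?_⟩
    have hb : (2 * (i : ℝ) + 1) ≠ 0 := by positivity
    rw [integral_aeval_mul_cos _ hb, sin_odd_mul_pi_div_two]
    simp
  | succ k ih =>
    obtain ⟨P, hP⟩ := exists_cos_moments_step ih
    refine ⟨P, fun i => (hP i).trans ?_⟩
    rw [div_div, ← pow_add]
    rfl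

/-! ### Integrals of polynomials against the cotangent -/

/-- Two integrations by parts replace `P` by `P''` and `r` by `r + 1`, whence the induction on the
degree. The boundary term at `π/2` is an alternating series, giving `log 2` when `r = 0`; the one at
`0` is `P(0)` times `∑ 1/(k+1)^(2r+1)`, so it must be absent when `r = 0`. -/
theorem seriesIn_integral_aeval_mul_sin (P : Polynomial parityRing) (r : ℕ)
    (h : Polynomial.aeval (0 : ℝ) P = 0 ∨ 1 ≤ r) :
    SeriesIn fun k => (∫ x in (0 : ℝ)..(Real.pi / 2),
      Polynomial.aeval x P * Real.sin (2 * ((k : ℝ) + 1) * x)) / ((k : ℝ) + 1) ^ (2 * r) := by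
  induction hn : P.natDegree using Nat.strong_induction_on generalizing P r with
  | _ n ih =>
  have hP2 : SeriesIn fun k => (∫ x in (0 : ℝ)..(Real.pi / 2),
      Polynomial.aeval x (Polynomial.derivative (Polynomial.derivative P)) *
        Real.sin (2 * ((k : ℝ) + 1) * x)) / ((k : ℝ) + 1) ^ (2 * (r + 1)) := by
    rcases Nat.eq_zero_or_pos n with h0 | h0
    · rw [Polynomial.derivative_of_natDegree_zero (hn.trans h0)]
      exact ⟨0, zero_mem _, by simp⟩
    · refine ih _ ?_ _ _ (Or.inr (by lia)) rfl
      have h1 := Polynomial.natDegree_derivative_le P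
      have h2 := Polynomial.natDegree_derivative_le (Polynomial.derivative P)
      lia
  have hA : SeriesIn fun k =>
      Polynomial.aeval (0 : ℝ) P / 2 * (1 / ((k : ℝ) + 1) ^ (2 * r + 1)) := by
    rcases h with h | h
    · rw [h]
      exact ⟨0, zero_mem _, by simp⟩
    · refine (seriesIn_one_div_succ_pow h).const_mul ?_
      simpa using div_natCast_mem_parityRing (aeval_mem_parityRing P (zero_mem _)) 2
  have hB : SeriesIn fun k =>
      Polynomial.aeval (Real.pi / 2) P / 2 * ((-1) ^ k / ((k : ℝ) + 1) ^ (2 * r + 1)) := by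
    refine (seriesIn_neg_one_pow_div_succ_pow r).const_mul ?_
    simpa using
      div_natCast_mem_parityRing (aeval_mem_parityRing P pi_div_two_mem_parityRing) 2
  refine ((hA.add hB).add (hP2.const_mul (ratCast_mem_parityRing (-1 / 4)))).congr fun k => ?_
  have hb : 2 * ((k : ℝ) + 1) ≠ 0 := by positivity
  have hk : (k : ℝ) + 1 ≠ 0 := by positivity
  have e : 2 * ((k : ℝ) + 1) * (Real.pi / 2) = ((k + 1 : ℕ) : ℝ) * Real.pi := by push_cast; ring
  rw [integral_aeval_mul_sin _ hb, integral_aeval_mul_cos _ hb, e, Real.cos_nat_mul_pi,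
    Real.sin_nat_mul_pi]
  push_cast
  field_simp
  ring

/-- The conjugate Dirichlet kernel: a truncated form of `cot x = 2 ∑ sin 2kx`, whose error terms
oscillate with frequency `2N` and disappear by Riemann–Lebesgue. -/
theorem cos_mul_one_sub_cos_two_nat_mul (x : ℝ) (N : ℕ) :
    Real.cos x * (1 - Real.cos (2 * N * x)) =
      (2 * (∑ k ∈ Finset.range N, Real.sin (2 * ((k : ℝ) + 1) * x)) - Real.sin (2 * N * x)) *
        Real.sin x := by
  induction N with
  | zero => simp
  | succ N ih =>
    rw [Finset.sum_range_succ]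
    have e : 2 * ((N + 1 : ℕ) : ℝ) * x = 2 * N * x + 2 * x := by push_cast; ring
    have e' : 2 * ((N : ℝ) + 1) * x = 2 * N * x + 2 * x := by ring
    rw [e, e', Real.cos_add, Real.sin_add, Real.cos_two_mul, Real.sin_two_mul]
    have h2 := Real.sin_sq_add_cos_sq x
    linear_combination ih + (-2 * Real.cos x * Real.cos (2 * N * x)) * h2

theorem div_sin_le {x : ℝ} (h0 : 0 < x) (h1 : x ≤ Real.pi / 2) : x / Real.sin x ≤ Real.pi / 2 := by
  have h := Real.mul_le_sin h0.le h1
  have hs : 0 < Real.sin x := Real.sin_pos_of_pos_of_lt_pi h0 (by linarith [Real.pi_pos])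
  rw [div_le_iff₀ hs]
  have := mul_le_mul_of_nonneg_left h Real.pi_div_two_pos.le
  have hp := Real.pi_ne_zero
  have e : Real.pi / 2 * (2 / Real.pi * x) = x := by field_simp
  linarith

theorem intervalIntegrable_of_bounded_Ioc {f : ℝ → ℝ} {b C : ℝ} (hb : 0 ≤ b) (hf : Measurable f)
    (h : ∀ x, 0 < x → x ≤ b → |f x| ≤ C) :
    IntervalIntegrable f MeasureTheory.volume 0 b := by
  rw [intervalIntegrable_iff_integrableOn_Ioc_of_le hb]
  refine MeasureTheory.IntegrableOn.of_bound (C := C) measure_Ioc_lt_top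
    hf.aestronglyMeasurable ?_
  filter_upwards [MeasureTheory.ae_restrict_mem measurableSet_Ioc] with x hx
  exact h x hx.1 hx.2

theorem intervalIntegrable_aeval_mul_cot (P : Polynomial parityRing)
    (h : Polynomial.aeval (0 : ℝ) P = 0) :
    IntervalIntegrable (fun x => Polynomial.aeval x P * (Real.cos x / Real.sin x))
      MeasureTheory.volume 0 (Real.pi / 2) := by
  have hc : P.coeff 0 = 0 := by
    rw [← Polynomial.coeff_zero_eq_aeval_zero'] at h
    exact Subtype.ext h
  -- The factor `x` cancels the pole of the cotangent at `0`.
  obtain ⟨Q, rfl⟩ := Polynomial.X_dvd_iff.2 hc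
  have h1 : IntervalIntegrable (fun x => x * (Real.cos x / Real.sin x))
      MeasureTheory.volume 0 (Real.pi / 2) := by
    refine intervalIntegrable_of_bounded_Ioc (C := Real.pi / 2) Real.pi_div_two_pos.le
      (by fun_prop) fun x h0 h1 => ?_
    have hs : 0 < Real.sin x := Real.sin_pos_of_pos_of_lt_pi h0 (by linarith [Real.pi_pos])
    rw [← mul_div_assoc, mul_comm, mul_div_assoc, abs_mul, abs_of_pos (div_pos h0 hs)]
    calc |Real.cos x| * (x / Real.sin x) ≤ 1 * (Real.pi / 2) :=
          mul_le_mul (Real.abs_cos_le_one x) (div_sin_le h0 h1) (by positivity) zero_le_one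
      _ = _ := one_mul _
  have h2 := h1.mul_continuousOn (g := fun x => Polynomial.aeval x Q) (by fun_prop)
  refine h2.congr fun x _ => ?_
  simp only [map_mul, Polynomial.aeval_X]
  ring

theorem integral_aeval_mul_cot_mem_parityRing (P : Polynomial parityRing)
    (h : Polynomial.aeval (0 : ℝ) P = 0) :
    ∫ x in (0 : ℝ)..(Real.pi / 2), Polynomial.aeval x P * (Real.cos x / Real.sin x)
      ∈ parityRing := by
  obtain ⟨L, hL, hS⟩ := seriesIn_integral_aeval_mul_sin P 0 (Or.inl h)
  have hi := intervalIntegrable_aeval_mul_cot P h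
  have h1 := (tendsto_integral_mul_cos_sin_two_mul Real.pi_div_two_pos.le hi).1
  have h2 := (tendsto_integral_mul_cos_sin_two_mul (g := fun x => Polynomial.aeval x P)
    Real.pi_div_two_pos.le (Continuous.intervalIntegrable (by fun_prop) _ _)).2
  have h3 := (h1.add (hS.const_mul 2)).sub h2
  have key : ∀ N : ℕ,
      (∫ x in (0 : ℝ)..(Real.pi / 2), Polynomial.aeval x P * (Real.cos x / Real.sin x) *
          Real.cos (2 * N * x)) +
        2 * (∑ k ∈ Finset.range N, (∫ x in (0 : ℝ)..(Real.pi / 2),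
          Polynomial.aeval x P * Real.sin (2 * ((k : ℝ) + 1) * x)) / ((k : ℝ) + 1) ^ (2 * 0)) -
        (∫ x in (0 : ℝ)..(Real.pi / 2), Polynomial.aeval x P * Real.sin (2 * N * x)) =
      ∫ x in (0 : ℝ)..(Real.pi / 2), Polynomial.aeval x P * (Real.cos x / Real.sin x) := by
    intro N
    have i1 : IntervalIntegrable (fun x => Polynomial.aeval x P * (Real.cos x / Real.sin x) *
        Real.cos (2 * N * x)) MeasureTheory.volume 0 (Real.pi / 2) :=
      hi.mul_continuousOn (by fun_prop)
    have i2 : ∀ k ∈ Finset.range N, IntervalIntegrable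
        (fun x => Polynomial.aeval x P * Real.sin (2 * ((k : ℝ) + 1) * x))
        MeasureTheory.volume 0 (Real.pi / 2) :=
      fun k _ => Continuous.intervalIntegrable (by fun_prop) _ _
    have i2' : IntervalIntegrable (fun x => ∑ k ∈ Finset.range N,
        Polynomial.aeval x P * Real.sin (2 * ((k : ℝ) + 1) * x))
        MeasureTheory.volume 0 (Real.pi / 2) := Continuous.intervalIntegrable (by fun_prop) _ _
    have i3 : IntervalIntegrable (fun x => Polynomial.aeval x P * Real.sin (2 * N * x))
        MeasureTheory.volume 0 (Real.pi / 2) := Continuous.intervalIntegrable (by fun_prop) _ _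
    simp only [mul_zero, pow_zero, div_one]
    rw [← intervalIntegral.integral_finsetSum i2, ← intervalIntegral.integral_const_mul,
      ← intervalIntegral.integral_add i1 (i2'.const_mul 2),
      ← intervalIntegral.integral_sub (i1.add (i2'.const_mul 2)) i3]
    refine intervalIntegral.integral_congr_ae (Eventually.of_forall fun x hx => ?_)
    rw [Set.uIoc_of_le Real.pi_div_two_pos.le] at hx
    have hs : Real.sin x ≠ 0 :=
      (Real.sin_pos_of_pos_of_lt_pi hx.1 (by linarith [hx.2, Real.pi_pos])).ne'
    have hk := cos_mul_one_sub_cos_two_nat_mul x N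
    rw [← Finset.mul_sum]
    have hk' := congrArg (· / Real.sin x) hk
    simp only [mul_div_cancel_right₀ _ hs] at hk'
    linear_combination -Polynomial.aeval x P * hk'
  have h4 := tendsto_nhds_unique (h3.congr key) tendsto_const_nhds
  rw [← h4]
  exact sub_mem (add_mem (zero_mem _) (mul_mem (natCast_mem_parityRing 2) hL)) (zero_mem _)

/-! ### Fourier series over odd frequencies with polynomial sum -/

/-- The factor `(2π)ⁿ` clears all powers of `1/π` from the coefficients, so these involve only
nonnegative powers of `π`. -/
theorem exists_aeval_eq_mul_eval_div (B : Polynomial ℚ) {n : ℕ} (hB : B.natDegree ≤ n) :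
    ∃ P : Polynomial parityRing, ∀ x : ℝ, Polynomial.aeval x P =
      (2 * Real.pi) ^ n * (B.map (algebraMap ℚ ℝ)).eval (x / (2 * Real.pi)) := by
  have hp : 2 * Real.pi ∈ parityRing := mul_mem (natCast_mem_parityRing 2) pi_mem_parityRing
  have hc : ∀ i, (B.coeff i : ℝ) * (2 * Real.pi) ^ (n - i) ∈ parityRing := fun i =>
    mul_mem (ratCast_mem_parityRing _) (pow_mem hp _)
  refine ⟨∑ i ∈ Finset.range (n + 1), Polynomial.C (⟨_, hc i⟩ : parityRing) * Polynomial.X ^ i,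
    fun x => ?_⟩
  rw [Polynomial.eval_eq_sum_range' (n := n + 1)
    ((Polynomial.natDegree_map_le).trans_lt (Nat.lt_succ_of_le hB)), Finset.mul_sum, map_sum]
  refine Finset.sum_congr rfl fun i hi => ?_
  have hi' : i ≤ n := Nat.lt_succ_iff.1 (Finset.mem_range.1 hi)
  rw [map_mul, map_pow, Polynomial.aeval_C, Polynomial.aeval_X, Polynomial.coeff_map, div_pow]
  have e : algebraMap parityRing ℝ ⟨_, hc i⟩ = (B.coeff i : ℝ) * (2 * Real.pi) ^ (n - i) := rfl
  have e2 : (2 * Real.pi) ^ n = (2 * Real.pi) ^ (n - i) * (2 * Real.pi) ^ i := by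
    rw [← pow_add, Nat.sub_add_cancel hi']
  have h0 : (2 * Real.pi) ^ i ≠ 0 := pow_ne_zero _ (by positivity)
  rw [e, e2, eq_ratCast]
  field_simp

theorem Polynomial.natDegree_bernoulli_le (n : ℕ) : (Polynomial.bernoulli n).natDegree ≤ n := by
  refine Polynomial.natDegree_sum_le_of_forall_le _ _ fun i _ => ?_
  exact (Polynomial.natDegree_monomial_le _).trans (Nat.sub_le _ _)

/-- If `∑ g (n x) / nᵐ` is a polynomial in `x` on `[0, 2π]`, then so is its part over odd `n`
on `[0, π / 2]`. -/
theorem exists_hasSum_odd {g : ℝ → ℝ} {m : ℕ} (h : ∃ P : Polynomial parityRing,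
      ∀ x ∈ Set.Icc 0 (2 * Real.pi),
        HasSum (fun n : ℕ => g (n * x) / (n : ℝ) ^ m) (Polynomial.aeval x P)) :
    ∃ P : Polynomial parityRing, ∀ x ∈ Set.Icc 0 (Real.pi / 2),
      HasSum (fun i : ℕ => g ((2 * (i : ℝ) + 1) * x) / (2 * (i : ℝ) + 1) ^ m)
        (Polynomial.aeval x P) := by
  obtain ⟨P, hP⟩ := h
  have hc : (1 : ℝ) / ((2 : ℕ) : ℝ) ^ m ∈ parityRing :=
    div_pow_natCast_mem_parityRing (one_mem _) 2 m
  refine ⟨P - Polynomial.C ⟨_, hc⟩ * P.comp (2 * Polynomial.X), fun x hx => ?_⟩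
  have h1 := hP x ⟨hx.1, by linarith [hx.2, Real.pi_pos]⟩
  have h2 := hP (2 * x) ⟨by linarith [hx.1], by linarith [hx.2, Real.pi_pos]⟩
  have h3 : HasSum (fun n : ℕ => g ((2 * n : ℕ) * x) / ((2 * n : ℕ) : ℝ) ^ m)
      (1 / ((2 : ℕ) : ℝ) ^ m * Polynomial.aeval (2 * x) P) := by
    refine (h2.mul_left _).congr_fun fun n => ?_
    push_cast
    rw [mul_pow, show 2 * (n : ℝ) * x = n * (2 * x) by ring]
    field_simp
  have h4 := h1.odd_of_even h3
  rw [map_sub, map_mul, Polynomial.aeval_C, Polynomial.aeval_comp, map_mul, Polynomial.aeval_X,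
    map_ofNat]
  simpa using h4

theorem exists_hasSum_cos {k : ℕ} (hk : 1 ≤ k) : ∃ P : Polynomial parityRing,
    ∀ x ∈ Set.Icc 0 (Real.pi / 2),
      HasSum (fun i : ℕ => Real.cos ((2 * (i : ℝ) + 1) * x) / (2 * (i : ℝ) + 1) ^ (2 * k))
        (Polynomial.aeval x P) := by
  refine exists_hasSum_odd ?_
  obtain ⟨B, hB⟩ := exists_aeval_eq_mul_eval_div _ (Polynomial.natDegree_bernoulli_le (2 * k))
  have hc : (((-1) ^ (k + 1) / 2 / ((2 * k).factorial : ℚ) : ℚ) : ℝ) ∈ parityRing :=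
    ratCast_mem_parityRing _
  refine ⟨Polynomial.C ⟨_, hc⟩ * B, fun x hx => ?_⟩
  have hp := Real.pi_pos
  have h := hasSum_one_div_nat_pow_mul_cos (k := k) (x := x / (2 * Real.pi)) (by lia)
    ⟨div_nonneg hx.1 (by positivity), div_le_one_of_le₀ hx.2 (by positivity)⟩
  rw [map_mul, Polynomial.aeval_C, hB]
  convert h using 1
  · ext n
    rw [show 2 * Real.pi * n * (x / (2 * Real.pi)) = n * x by field_simp]
    ring
  · have e : algebraMap parityRing ℝ ⟨_, hc⟩ =
      (((-1) ^ (k + 1) / 2 / ((2 * k).factorial : ℚ) : ℚ) : ℝ) := rfl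
    rw [e]
    push_cast
    ring

theorem exists_hasSum_sin {k : ℕ} (hk : 1 ≤ k) : ∃ P : Polynomial parityRing,
    ∀ x ∈ Set.Icc 0 (Real.pi / 2),
      HasSum (fun i : ℕ => Real.sin ((2 * (i : ℝ) + 1) * x) / (2 * (i : ℝ) + 1) ^ (2 * k + 1))
        (Polynomial.aeval x P) := by
  refine exists_hasSum_odd ?_
  obtain ⟨B, hB⟩ := exists_aeval_eq_mul_eval_div _ (Polynomial.natDegree_bernoulli_le (2 * k + 1))
  have hc : (((-1) ^ (k + 1) / 2 / ((2 * k + 1).factorial : ℚ) : ℚ) : ℝ) ∈ parityRing :=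
    ratCast_mem_parityRing _
  refine ⟨Polynomial.C ⟨_, hc⟩ * B, fun x hx => ?_⟩
  have hp := Real.pi_pos
  have h := hasSum_one_div_nat_pow_mul_sin (k := k) (x := x / (2 * Real.pi)) (by lia)
    ⟨div_nonneg hx.1 (by positivity), div_le_one_of_le₀ hx.2 (by positivity)⟩
  rw [map_mul, Polynomial.aeval_C, hB]
  convert h using 1
  · ext n
    rw [show 2 * Real.pi * n * (x / (2 * Real.pi)) = n * x by field_simp]
    ring
  · have e : algebraMap parityRing ℝ ⟨_, hc⟩ =
      (((-1) ^ (k + 1) / 2 / ((2 * k + 1).factorial : ℚ) : ℚ) : ℝ) := rfl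
    rw [e]
    push_cast
    ring

/-- Reflection `x ↦ π / 2 - x` of a trigonometric series with polynomial sum. -/
theorem exists_hasSum_reflect {u : ℕ → ℝ → ℝ} (h : ∃ P : Polynomial parityRing,
      ∀ x ∈ Set.Icc 0 (Real.pi / 2), HasSum (fun i => u i x) (Polynomial.aeval x P)) :
    ∃ P : Polynomial parityRing, ∀ x ∈ Set.Icc 0 (Real.pi / 2),
      HasSum (fun i => u i (Real.pi / 2 - x)) (Polynomial.aeval x P) := by
  obtain ⟨P, hP⟩ := h
  refine ⟨P.comp (Polynomial.C ⟨_, pi_div_two_mem_parityRing⟩ - Polynomial.X), fun x hx => ?_⟩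
  rw [Polynomial.aeval_comp, map_sub, Polynomial.aeval_C, Polynomial.aeval_X]
  exact hP _ ⟨by linarith [hx.2], by linarith [hx.1]⟩

/-- The reflection `x ↦ π/2 - x` turns `cos((2i+1)x)` into `(-1)ⁱ sin((2i+1)x)`. -/
theorem exists_hasSum_alternating_sin {k : ℕ} (hk : 1 ≤ k) : ∃ P : Polynomial parityRing,
    ∀ x ∈ Set.Icc 0 (Real.pi / 2),
      HasSum (fun i : ℕ => (-1) ^ i / (2 * (i : ℝ) + 1) ^ (2 * k) *
        Real.sin ((2 * (i : ℝ) + 1) * x)) (Polynomial.aeval x P) := by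
  obtain ⟨P, hP⟩ := exists_hasSum_reflect (exists_hasSum_cos hk)
  refine ⟨P, fun x hx => (hP x hx).congr_fun fun i => ?_⟩
  rw [mul_sub, Real.cos_sub, cos_odd_mul_pi_div_two, sin_odd_mul_pi_div_two]
  ring

theorem exists_hasSum_alternating_cos {k : ℕ} (hk : 1 ≤ k) : ∃ P : Polynomial parityRing,
    ∀ x ∈ Set.Icc 0 (Real.pi / 2),
      HasSum (fun i : ℕ => (-1) ^ i / (2 * (i : ℝ) + 1) ^ (2 * k + 1) *
        Real.cos ((2 * (i : ℝ) + 1) * x)) (Polynomial.aeval x P) := by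
  obtain ⟨P, hP⟩ := exists_hasSum_reflect (exists_hasSum_sin hk)
  refine ⟨P, fun x hx => (hP x hx).congr_fun fun i => ?_⟩
  rw [mul_sub, Real.sin_sub, cos_odd_mul_pi_div_two, sin_odd_mul_pi_div_two]
  ring

/-! ### Kernels for the inner sums, and termwise integration -/

theorem sin_odd_mul_cos (x : ℝ) (i : ℕ) :
    Real.sin ((2 * (i : ℝ) + 1) * x) * Real.cos x =
      (Real.cos ((2 * (i : ℝ) + 1) * x) +
        2 * ∑ j ∈ Finset.range i, Real.cos ((2 * (j : ℝ) + 1) * x)) * Real.sin x := by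
  induction i with
  | zero => simp; ring
  | succ i ih =>
    rw [Finset.sum_range_succ]
    have e : (2 * ((i + 1 : ℕ) : ℝ) + 1) * x = (2 * (i : ℝ) + 1) * x + 2 * x := by push_cast; ring
    rw [e, Real.cos_add, Real.sin_add, Real.cos_two_mul, Real.sin_two_mul]
    have h2 := Real.sin_sq_add_cos_sq x
    linear_combination ih + (2 * Real.sin ((2 * (i : ℝ) + 1) * x) * Real.cos x) * h2

/-- The sine analogue of `sin_odd_mul_cos`. It serves `1/(2j+1)`, which is the integral of
`sin((2j+1)x)` over `[0, π/2]`. -/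
theorem one_sub_cos_mul_cos_odd (x : ℝ) (i : ℕ) :
    1 - Real.cos x * Real.cos ((2 * (i : ℝ) + 1) * x) =
      (Real.sin ((2 * (i : ℝ) + 1) * x) +
        2 * ∑ j ∈ Finset.range i, Real.sin ((2 * (j : ℝ) + 1) * x)) * Real.sin x := by
  induction i with
  | zero =>
    have h2 := Real.sin_sq_add_cos_sq x
    simp
    linear_combination -h2
  | succ i ih =>
    rw [Finset.sum_range_succ]
    have e : (2 * ((i + 1 : ℕ) : ℝ) + 1) * x = (2 * (i : ℝ) + 1) * x + 2 * x := by push_cast; ring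
    rw [e, Real.cos_add, Real.sin_add, Real.cos_two_mul, Real.sin_two_mul]
    have h2 := Real.sin_sq_add_cos_sq x
    linear_combination ih - (2 * Real.cos ((2 * (i : ℝ) + 1) * x) * Real.cos x) * h2

/-- With `a = 2i+1`, terms of size `sin(ax) / (a² x)` need an exponent between the bounds `1` and
`ax`: the first leaves a nonintegrable `1/x`, the second a divergent `∑ 1/a`. The square root gives
`a^(-3/2) x^(-1/2)`, which is both summable and integrable. -/
theorem abs_sin_le_sqrt {y : ℝ} (hy : 0 ≤ y) : |Real.sin y| ≤ √y := by
  refine Real.abs_le_sqrt ?_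
  have h1 := Real.abs_sin_le_one y
  have h2 : |Real.sin y| ≤ y := by simpa [abs_of_nonneg hy] using Real.abs_sin_le_abs (x := y)
  rw [← sq_abs, sq]
  nlinarith [abs_nonneg (Real.sin y)]

theorem one_sub_cos_le_two_mul_sqrt {y : ℝ} (hy : 0 ≤ y) : 1 - Real.cos y ≤ 2 * √y := by
  have h := abs_sin_le_sqrt (y := y / 2) (by linarith)
  have h1 := Real.abs_sin_le_one (y / 2)
  have h2 : √(y / 2) ≤ √y := Real.sqrt_le_sqrt (by linarith)
  have h3 : 1 - Real.cos y = 2 * |Real.sin (y / 2)| ^ 2 := by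
    have e : Real.cos y = Real.cos (2 * (y / 2)) := by congr 1; ring
    rw [sq_abs, e, Real.cos_two_mul]
    linear_combination -2 * Real.sin_sq_add_cos_sq (y / 2)
  nlinarith [abs_nonneg (Real.sin (y / 2))]

theorem summable_sqrt_div_sq_odd :
    Summable fun i : ℕ => √(2 * (i : ℝ) + 1) / (2 * (i : ℝ) + 1) ^ 2 := by
  have h : Summable fun i : ℕ => ((2 * i + 1 : ℕ) : ℝ) ^ (-3 / 2 : ℝ) :=
    (Real.summable_nat_rpow (p := -3 / 2).2 (by norm_num)).comp_injective
      (i := fun n => 2 * n + 1) (fun a b h => by simpa using h)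
  refine h.congr fun i => ?_
  have hp : (0 : ℝ) < 2 * (i : ℝ) + 1 := by positivity
  push_cast
  rw [Real.sqrt_eq_rpow, ← Real.rpow_natCast, ← Real.rpow_sub hp]
  norm_num

theorem intervalIntegrable_sqrt_div_self (b : ℝ) (hb : 0 ≤ b) :
    IntervalIntegrable (fun x => √x / x) MeasureTheory.volume 0 b := by
  have h := intervalIntegral.intervalIntegrable_rpow' (a := 0) (b := b) (r := -1 / 2) (by norm_num)
  refine h.congr fun x hx => ?_
  rw [Set.uIoc_of_le hb] at hx
  have := Real.rpow_sub hx.1 (1 / 2) 1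
  rw [Real.rpow_one] at this
  simp only [Real.sqrt_eq_rpow, ← this]
  norm_num

/-- Termwise integration on `(0, π / 2]` of a series dominated by `∑ a^(-3/2) x^(-1/2)`. -/
theorem hasSum_integral_of_le_sqrt {u : ℕ → ℝ → ℝ} {F : ℝ → ℝ} {C : ℝ}
    (hu : ∀ i, Measurable (u i))
    (hb : ∀ i x, 0 < x → x ≤ Real.pi / 2 → |u i x| ≤
      C * (√((2 * (i : ℝ) + 1) * x) / ((2 * (i : ℝ) + 1) ^ 2 * x)))
    (hF : ∀ x, 0 < x → x ≤ Real.pi / 2 → HasSum (fun i => u i x) (F x)) :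
    HasSum (fun i => ∫ x in (0 : ℝ)..(Real.pi / 2), u i x)
      (∫ x in (0 : ℝ)..(Real.pi / 2), F x) := by
  have hpi := Real.pi_div_two_pos.le
  have hI : Set.uIoc 0 (Real.pi / 2) = Set.Ioc 0 (Real.pi / 2) := Set.uIoc_of_le hpi
  refine intervalIntegral.hasSum_integral_of_dominated_convergence
    (fun i x => C * (√(2 * (i : ℝ) + 1) / (2 * (i : ℝ) + 1) ^ 2 * (√x / x)))
    (fun i => (hu i).aestronglyMeasurable) (fun i => Eventually.of_forall fun x hx => ?_)
    (Eventually.of_forall fun x _ => (summable_sqrt_div_sq_odd.mul_right _).mul_left _) ?_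
    (Eventually.of_forall fun x hx => ?_)
  · rw [hI] at hx
    refine (hb i x hx.1 hx.2).trans_eq ?_
    rw [Real.sqrt_mul (by positivity), div_mul_div_comm]
  · simp_rw [tsum_mul_left, tsum_mul_right]
    exact ((intervalIntegrable_sqrt_div_self _ hpi).const_mul _).const_mul _
  · rw [hI] at hx
    exact hF x hx.1 hx.2

theorem sin_pos_of_mem_Ioc {x : ℝ} (h0 : 0 < x) (h1 : x ≤ Real.pi / 2) : 0 < Real.sin x :=
  Real.sin_pos_of_pos_of_lt_pi h0 (by linarith [Real.pi_pos])

theorem one_div_sin_le {x : ℝ} (h0 : 0 < x) (h1 : x ≤ Real.pi / 2) :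
    1 / Real.sin x ≤ Real.pi / 2 * (1 / x) := by
  have h := div_sin_le h0 h1
  have hs := sin_pos_of_mem_Ioc h0 h1
  rw [mul_one_div, le_div_iff₀ h0]
  calc 1 / Real.sin x * x = x / Real.sin x := by ring
    _ ≤ _ := h

theorem integral_aeval_mul_sin_odd_mul_cot {P : Polynomial parityRing} {g : ℕ → ℝ}
    (hP : ∀ i : ℕ, ∫ x in (0 : ℝ)..(Real.pi / 2),
      Polynomial.aeval x P * Real.cos ((2 * (i : ℝ) + 1) * x) = g i) (i : ℕ) :
    ∫ x in (0 : ℝ)..(Real.pi / 2), Polynomial.aeval x P *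
      (Real.sin ((2 * (i : ℝ) + 1) * x) * (Real.cos x / Real.sin x)) =
      g i + 2 * ∑ j ∈ Finset.range i, g j := by
  have i1 : ∀ j : ℕ, IntervalIntegrable
      (fun x => Polynomial.aeval x P * Real.cos ((2 * (j : ℝ) + 1) * x))
      MeasureTheory.volume 0 (Real.pi / 2) :=
    fun j => Continuous.intervalIntegrable (by fun_prop) _ _
  have i2 : IntervalIntegrable (fun x => ∑ j ∈ Finset.range i,
      Polynomial.aeval x P * Real.cos ((2 * (j : ℝ) + 1) * x))
      MeasureTheory.volume 0 (Real.pi / 2) := Continuous.intervalIntegrable (by fun_prop) _ _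
  simp_rw [← hP]
  rw [← intervalIntegral.integral_finsetSum fun j _ => i1 j,
    ← intervalIntegral.integral_const_mul, ← intervalIntegral.integral_add (i1 i) (i2.const_mul 2)]
  refine intervalIntegral.integral_congr_ae (Eventually.of_forall fun x hx => ?_)
  rw [Set.uIoc_of_le Real.pi_div_two_pos.le] at hx
  have hs := (sin_pos_of_mem_Ioc hx.1 hx.2).ne'
  rw [← mul_div_assoc, sin_odd_mul_cos, mul_div_cancel_right₀ _ hs, ← Finset.mul_sum]
  ring

theorem integral_sin_odd_mul (i : ℕ) :
    ∫ x in (0 : ℝ)..(Real.pi / 2), Real.sin ((2 * (i : ℝ) + 1) * x) = 1 / (2 * (i : ℝ) + 1) := by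
  have hb : (2 * (i : ℝ) + 1) ≠ 0 := by positivity
  have h := integral_aeval_mul_sin 1 hb (Real.pi / 2)
  rw [cos_odd_mul_pi_div_two] at h
  simpa using h

theorem intervalIntegrable_one_sub_cos_mul_cos_odd_div_sin (i : ℕ) :
    IntervalIntegrable (fun x => (1 - Real.cos x * Real.cos ((2 * (i : ℝ) + 1) * x)) / Real.sin x)
      MeasureTheory.volume 0 (Real.pi / 2) := by
  have h : IntervalIntegrable (fun x => Real.sin ((2 * (i : ℝ) + 1) * x) +
        2 * ∑ j ∈ Finset.range i, Real.sin ((2 * (j : ℝ) + 1) * x))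
      MeasureTheory.volume 0 (Real.pi / 2) := Continuous.intervalIntegrable (by fun_prop) _ _
  refine h.congr fun x hx => ?_
  rw [Set.uIoc_of_le Real.pi_div_two_pos.le] at hx
  have hs := (sin_pos_of_mem_Ioc hx.1 hx.2).ne'
  simp only [one_sub_cos_mul_cos_odd, mul_div_cancel_right₀ _ hs]

theorem integral_one_sub_cos_mul_cos_odd_div_sin (i : ℕ) :
    ∫ x in (0 : ℝ)..(Real.pi / 2),
        (1 - Real.cos x * Real.cos ((2 * (i : ℝ) + 1) * x)) / Real.sin x =
      1 / (2 * (i : ℝ) + 1) + 2 * ∑ j ∈ Finset.range i, 1 / (2 * (j : ℝ) + 1) := by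
  have i1 : ∀ j : ℕ, IntervalIntegrable (fun x => Real.sin ((2 * (j : ℝ) + 1) * x))
      MeasureTheory.volume 0 (Real.pi / 2) :=
    fun j => Continuous.intervalIntegrable (by fun_prop) _ _
  have i2 : IntervalIntegrable (fun x => ∑ j ∈ Finset.range i, Real.sin ((2 * (j : ℝ) + 1) * x))
      MeasureTheory.volume 0 (Real.pi / 2) := Continuous.intervalIntegrable (by fun_prop) _ _
  simp_rw [← integral_sin_odd_mul]
  rw [← intervalIntegral.integral_finsetSum fun j _ => i1 j,
    ← intervalIntegral.integral_const_mul, ← intervalIntegral.integral_add (i1 i) (i2.const_mul 2)]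
  refine intervalIntegral.integral_congr_ae (Eventually.of_forall fun x hx => ?_)
  rw [Set.uIoc_of_le Real.pi_div_two_pos.le] at hx
  have hs := (sin_pos_of_mem_Ioc hx.1 hx.2).ne'
  rw [one_sub_cos_mul_cos_odd, mul_div_cancel_right₀ _ hs]

theorem one_sub_cos_div_sin_eq {x : ℝ} (h0 : 0 < x) (h1 : x ≤ Real.pi / 2) :
    (1 - Real.cos x) / Real.sin x = Real.sin (x / 2) / Real.cos (x / 2) := by
  have hs := (sin_pos_of_mem_Ioc h0 h1).ne'
  have hc : Real.cos (x / 2) ≠ 0 :=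
    (Real.cos_pos_of_mem_Ioo ⟨by linarith [Real.pi_pos], by linarith [Real.pi_pos]⟩).ne'
  have e : x = 2 * (x / 2) := by ring
  rw [div_eq_div_iff hs hc]
  conv_lhs => rw [e, Real.cos_two_mul]
  conv_rhs => rw [e, Real.sin_two_mul]
  rw [show 2 * (x / 2) / 2 = x / 2 by ring]
  linear_combination (-2 * Real.cos (x / 2)) * Real.sin_sq_add_cos_sq (x / 2)

theorem intervalIntegrable_one_sub_cos_div_sin :
    IntervalIntegrable (fun x => (1 - Real.cos x) / Real.sin x)
      MeasureTheory.volume 0 (Real.pi / 2) := by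
  refine intervalIntegrable_of_bounded_Ioc (C := 1) Real.pi_div_two_pos.le (by fun_prop)
    fun x h0 h1 => ?_
  have hs := sin_pos_of_mem_Ioc h0 h1
  have hc : 0 ≤ Real.cos x := Real.cos_nonneg_of_mem_Icc ⟨by linarith [Real.pi_pos], h1⟩
  rw [abs_div, abs_of_pos hs, div_le_one hs, abs_of_nonneg (by linarith [Real.cos_le_one x])]
  nlinarith [Real.sin_sq_add_cos_sq x, Real.sin_le_one x]

/-- The integrand is `tan(x/2)`, with antiderivative `-2 log cos(x/2)`. -/
theorem integral_one_sub_cos_div_sin :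
    ∫ x in (0 : ℝ)..(Real.pi / 2), (1 - Real.cos x) / Real.sin x = Real.log 2 := by
  have hpi := Real.pi_pos
  have hc : ∀ x ∈ Set.uIcc 0 (Real.pi / 2), Real.cos (x / 2) ≠ 0 := fun x hx => by
    rw [Set.uIcc_of_le Real.pi_div_two_pos.le] at hx
    exact (Real.cos_pos_of_mem_Ioo ⟨by linarith [hx.1], by linarith [hx.2]⟩).ne'
  have h1 : ∫ x in (0 : ℝ)..(Real.pi / 2), (1 - Real.cos x) / Real.sin x =
      ∫ x in (0 : ℝ)..(Real.pi / 2), Real.sin (x / 2) / Real.cos (x / 2) := by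
    refine intervalIntegral.integral_congr_ae (Eventually.of_forall fun x hx => ?_)
    rw [Set.uIoc_of_le Real.pi_div_two_pos.le] at hx
    exact one_sub_cos_div_sin_eq hx.1 hx.2
  rw [h1, intervalIntegral.integral_eq_sub_of_hasDerivAt
    (f := fun x => -2 * Real.log (Real.cos (x / 2)))]
  · rw [show Real.pi / 2 / 2 = Real.pi / 4 by ring, Real.cos_pi_div_four, zero_div, Real.cos_zero,
      Real.log_one, Real.log_div (by positivity) two_ne_zero, Real.log_sqrt zero_le_two]
    ring
  · intro x hx
    have h := ((((hasDerivAt_id x).div_const 2).cos).log (hc x hx)).const_mul (-2)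
    refine h.congr_deriv ?_
    simp only [id]
    ring
  · refine ContinuousOn.intervalIntegrable ?_
    exact ContinuousOn.div (by fun_prop) (by fun_prop) hc

/-! ### Double series with outer exponent at least 2 -/

theorem SeriesIn.of_two_mul_add {f g : ℕ → ℝ} (hd : SeriesIn fun i => f i * g i)
    (h : SeriesIn fun i => f i * (g i + 2 * ∑ j ∈ Finset.range i, g j)) :
    SeriesIn fun i => f i * ∑ j ∈ Finset.range i, g j := by
  refine ((h.const_mul (ratCast_mem_parityRing (1 / 2))).add
    (hd.const_mul (ratCast_mem_parityRing (-1 / 2)))).congr fun i => ?_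
  push_cast
  ring

theorem seriesIn_mul_sum_of_cos_moments {f g : ℕ → ℝ} (hf : ∀ i, |f i| ≤ 1 / (2 * (i : ℝ) + 1) ^ 2)
    (hfP : ∃ P : Polynomial parityRing, ∀ x ∈ Set.Icc 0 (Real.pi / 2),
      HasSum (fun i : ℕ => f i * Real.sin ((2 * (i : ℝ) + 1) * x)) (Polynomial.aeval x P))
    (hgP : ∃ P : Polynomial parityRing, ∀ i : ℕ, ∫ x in (0 : ℝ)..(Real.pi / 2),
      Polynomial.aeval x P * Real.cos ((2 * (i : ℝ) + 1) * x) = g i)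
    (hd : SeriesIn fun i => f i * g i) :
    SeriesIn fun i => f i * ∑ j ∈ Finset.range i, g j := by
  refine SeriesIn.of_two_mul_add hd ?_
  obtain ⟨P, hP⟩ := hfP
  obtain ⟨Q, hQ⟩ := hgP
  -- A sine series vanishes at `0`, so the cotangent integral converges.
  have hP0 : Polynomial.aeval (0 : ℝ) (Q * P) = 0 := by
    have h := hP 0 ⟨le_rfl, Real.pi_div_two_pos.le⟩
    simp only [mul_zero, Real.sin_zero] at h
    rw [map_mul, h.unique hasSum_zero, mul_zero]
  obtain ⟨K, hK⟩ := (isCompact_Icc (a := (0 : ℝ)) (b := Real.pi / 2)).exists_bound_of_continuousOn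
    (f := fun x => Polynomial.aeval x Q) (by fun_prop)
  refine HasSum.seriesIn ?_ (integral_aeval_mul_cot_mem_parityRing (Q * P) hP0)
  refine (hasSum_integral_of_le_sqrt (C := K * (Real.pi / 2)) (u := fun i x => f i *
    (Polynomial.aeval x Q * (Real.sin ((2 * (i : ℝ) + 1) * x) * (Real.cos x / Real.sin x))))
    (fun i => ?_) (fun i x h0 h1 => ?_) (fun x h0 h1 => ?_)).congr_fun fun i => ?_
  · have hm : Measurable fun x : ℝ => Polynomial.aeval x Q :=
      (Polynomial.continuous_aeval Q).measurable
    fun_prop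
  · have ha : (0 : ℝ) < 2 * (i : ℝ) + 1 := by positivity
    have hs := sin_pos_of_mem_Ioc h0 h1
    have h2 := hK x ⟨h0.le, h1⟩
    have hK0 : 0 ≤ K := (norm_nonneg _).trans h2
    have h3 := abs_sin_le_sqrt (y := (2 * (i : ℝ) + 1) * x) (by positivity)
    have h4 : |Real.cos x / Real.sin x| ≤ Real.pi / 2 * (1 / x) := by
      rw [abs_div, abs_of_pos hs]
      refine le_trans ?_ (one_div_sin_le h0 h1)
      gcongr
      exact Real.abs_cos_le_one x
    rw [abs_mul, abs_mul, abs_mul]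
    calc _ ≤ 1 / (2 * (i : ℝ) + 1) ^ 2 * (K * (√((2 * (i : ℝ) + 1) * x) *
          (Real.pi / 2 * (1 / x)))) := by
          gcongr
          · exact hf i
          · exact h2
      _ = _ := by field_simp
  · have h := (hP x ⟨h0.le, h1⟩).mul_left (Polynomial.aeval x Q * (Real.cos x / Real.sin x))
    rw [map_mul]
    rw [mul_right_comm]
    exact h.congr_fun fun i => by ring
  · rw [intervalIntegral.integral_const_mul, integral_aeval_mul_sin_odd_mul_cot hQ]

/-- Summing the kernel against `f` gives `(P(0) - cos x P(x)) / sin x`, which splits as `P(0) (1 -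
cos x) / sin x + (P(0) - P(x)) cot x`; the first part contributes `P(0) log 2`. -/
theorem seriesIn_mul_sum_one_div_odd {f : ℕ → ℝ} (hf : ∀ i, |f i| ≤ 1 / (2 * (i : ℝ) + 1) ^ 2)
    (hfP : ∃ P : Polynomial parityRing, ∀ x ∈ Set.Icc 0 (Real.pi / 2),
      HasSum (fun i : ℕ => f i * Real.cos ((2 * (i : ℝ) + 1) * x)) (Polynomial.aeval x P))
    (hd : SeriesIn fun i => f i * (1 / (2 * (i : ℝ) + 1))) :
    SeriesIn fun i => f i * ∑ j ∈ Finset.range i, 1 / (2 * (j : ℝ) + 1) := by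
  refine SeriesIn.of_two_mul_add (g := fun i => 1 / (2 * (i : ℝ) + 1)) hd ?_
  obtain ⟨P, hP⟩ := hfP
  have hc := aeval_mem_parityRing P (zero_mem _)
  have hPc : ∀ x : ℝ, Polynomial.aeval x (Polynomial.C (⟨_, hc⟩ : parityRing) - P) =
      Polynomial.aeval (0 : ℝ) P - Polynomial.aeval x P := fun x => by
    rw [map_sub, Polynomial.aeval_C]
    rfl
  have h00 : Polynomial.aeval (0 : ℝ) (Polynomial.C (⟨_, hc⟩ : parityRing) - P) = 0 := by
    rw [hPc, sub_self]
  have hI : ∫ x in (0 : ℝ)..(Real.pi / 2),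
      (Polynomial.aeval (0 : ℝ) P * ((1 - Real.cos x) / Real.sin x) +
        Polynomial.aeval x (Polynomial.C (⟨_, hc⟩ : parityRing) - P) *
          (Real.cos x / Real.sin x)) ∈ parityRing := by
    rw [intervalIntegral.integral_add (intervalIntegrable_one_sub_cos_div_sin.const_mul _)
      (intervalIntegrable_aeval_mul_cot _ h00), intervalIntegral.integral_const_mul,
      integral_one_sub_cos_div_sin]
    exact add_mem (mul_mem hc log_two_mem_parityRing)
      (integral_aeval_mul_cot_mem_parityRing _ h00)
  refine HasSum.seriesIn ?_ hI
  refine (hasSum_integral_of_le_sqrt (C := 4 * (Real.pi / 2)) (u := fun i x => f i *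
    ((1 - Real.cos x * Real.cos ((2 * (i : ℝ) + 1) * x)) / Real.sin x))
    (fun i => by fun_prop) (fun i x h0 h1 => ?_) (fun x h0 h1 => ?_)).congr_fun fun i => ?_
  · have ha : (1 : ℝ) ≤ 2 * (i : ℝ) + 1 := by
      have : (0 : ℝ) ≤ i := Nat.cast_nonneg i
      linarith
    have hs := sin_pos_of_mem_Ioc h0 h1
    have h2 := one_sub_cos_le_two_mul_sqrt h0.le
    have h3 := one_sub_cos_le_two_mul_sqrt (y := (2 * (i : ℝ) + 1) * x) (by positivity)
    have h4 : √x ≤ √((2 * (i : ℝ) + 1) * x) := Real.sqrt_le_sqrt (by nlinarith)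
    have hcx : 0 ≤ Real.cos x := Real.cos_nonneg_of_mem_Icc ⟨by linarith [Real.pi_pos], h1⟩
    have h5 : |1 - Real.cos x * Real.cos ((2 * (i : ℝ) + 1) * x)| ≤
        4 * √((2 * (i : ℝ) + 1) * x) := by
      rw [abs_le]
      constructor <;>
        nlinarith [Real.cos_le_one x, Real.cos_le_one ((2 * (i : ℝ) + 1) * x),
          Real.sqrt_nonneg ((2 * (i : ℝ) + 1) * x)]
    rw [abs_mul, abs_div, abs_of_pos hs, div_eq_mul_one_div]
    calc _ ≤ 1 / (2 * (i : ℝ) + 1) ^ 2 * (4 * √((2 * (i : ℝ) + 1) * x) *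
          (Real.pi / 2 * (1 / x))) := by
          gcongr
          · exact hf i
          · exact one_div_sin_le h0 h1
      _ = _ := by field_simp
  · have hs := (sin_pos_of_mem_Ioc h0 h1).ne'
    have h := (hP 0 ⟨le_rfl, Real.pi_div_two_pos.le⟩).sub
      ((hP x ⟨h0.le, h1⟩).mul_left (Real.cos x))
    simp only [mul_zero, Real.cos_zero, mul_one] at h
    have h' := h.div_const (Real.sin x)
    rw [hPc]
    have e : Polynomial.aeval (0 : ℝ) P * ((1 - Real.cos x) / Real.sin x) +
        (Polynomial.aeval (0 : ℝ) P - Polynomial.aeval x P) * (Real.cos x / Real.sin x) =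
        (Polynomial.aeval (0 : ℝ) P - Real.cos x * Polynomial.aeval x P) / Real.sin x := by ring
    rw [e]
    exact h'.congr_fun fun i => by ring
  · rw [intervalIntegral.integral_const_mul, integral_one_sub_cos_mul_cos_odd_div_sin]

/-! ### The conditionally convergent case with both exponents 1 -/

theorem two_mul_cos_mul_sum_alternating_sin (x : ℝ) (N : ℕ) :
    2 * Real.cos x * ∑ i ∈ Finset.range N, (-1) ^ i * Real.sin ((2 * (i : ℝ) + 1) * x) =
      -((-1) ^ N * Real.sin (2 * N * x)) := by
  induction N with
  | zero => simp
  | succ N ih =>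
    rw [Finset.sum_range_succ, mul_add, ih]
    have e : 2 * ((N + 1 : ℕ) : ℝ) * x = 2 * N * x + 2 * x := by push_cast; ring
    have e' : (2 * (N : ℝ) + 1) * x = 2 * N * x + x := by ring
    rw [e, e', Real.sin_add, Real.sin_add, Real.cos_two_mul, Real.sin_two_mul, pow_succ]
    ring

theorem hasDerivAt_sum_alternating_one_sub_cos (x : ℝ) (N : ℕ) :
    HasDerivAt (fun y => ∑ i ∈ Finset.range N,
        (-1) ^ i / (2 * (i : ℝ) + 1) * (1 - Real.cos ((2 * (i : ℝ) + 1) * y)))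
      (∑ i ∈ Finset.range N, (-1) ^ i * Real.sin ((2 * (i : ℝ) + 1) * x)) x := by
  refine HasDerivAt.fun_sum fun i _ => ?_
  have ha : (2 * (i : ℝ) + 1) ≠ 0 := by positivity
  have h := ((((hasDerivAt_id x).const_mul (2 * (i : ℝ) + 1)).cos).const_sub 1).const_mul
    ((-1) ^ i / (2 * (i : ℝ) + 1))
  refine h.congr_deriv ?_
  simp only [id]
  field_simp

theorem sum_alternating_sin_eq_div {x : ℝ} (hx : Real.cos x ≠ 0) (N : ℕ) :
    ∑ i ∈ Finset.range N, (-1) ^ i * Real.sin ((2 * (i : ℝ) + 1) * x) =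
      -(-1) ^ N * (1 / (2 * Real.cos x) * Real.sin (2 * N * x)) := by
  have h := two_mul_cos_mul_sum_alternating_sin x N
  rw [← mul_left_cancel_iff_of_pos (zero_lt_two' ℝ), ← mul_right_inj' hx]
  linear_combination h + (-1) ^ N * Real.sin (2 * N * x) * mul_inv_cancel₀ hx

/-- The derivative of the sum is `± sin(2Ny) / (2 cos y)`, at most `1 / (2 cos x)` in absolute value
on `[0, x]`; the mean value inequality concludes. The resulting factor `1 / cos x` is later
cancelled by `cot x`. -/
theorem abs_sum_alternating_one_sub_cos_le {x : ℝ} (h0 : 0 ≤ x) (h1 : x < Real.pi / 2) (N : ℕ) :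
    |∑ i ∈ Finset.range N, (-1) ^ i / (2 * (i : ℝ) + 1) * (1 - Real.cos ((2 * (i : ℝ) + 1) * x))|
      ≤ 1 / (2 * Real.cos x) * x := by
  have hcx : 0 < Real.cos x := Real.cos_pos_of_mem_Ioo ⟨by linarith [Real.pi_pos], h1⟩
  have h := (convex_Icc 0 x).norm_image_sub_le_of_norm_hasDerivWithin_le (C := 1 / (2 * Real.cos x))
    (fun y _ => (hasDerivAt_sum_alternating_one_sub_cos y N).hasDerivWithinAt)
    (fun y hy => ?_) (Set.left_mem_Icc.2 h0) (Set.right_mem_Icc.2 h0)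
  · simpa [abs_of_nonneg h0] using h
  · have hxy : Real.cos x ≤ Real.cos y :=
      Real.cos_le_cos_of_nonneg_of_le_pi hy.1 (by linarith [Real.pi_pos]) hy.2
    have hcy := hcx.trans_le hxy
    rw [sum_alternating_sin_eq_div hcy.ne', Real.norm_eq_abs, abs_mul, abs_neg, abs_pow, abs_neg,
      abs_one, one_pow, one_mul, abs_mul, abs_of_pos (by positivity)]
    calc _ ≤ 1 / (2 * Real.cos x) * 1 := by
          gcongr
          exact Real.abs_sin_le_one _
      _ = _ := mul_one _

/-- Up to sign the sum is `∫ sin(2Ny) / (2 cos y)` over `[0, x]`, and Riemann–Lebesgue applies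
because `x` stays below `π/2`. -/
theorem tendsto_sum_alternating_one_sub_cos {x : ℝ} (h0 : 0 ≤ x) (h1 : x < Real.pi / 2) :
    Tendsto (fun N => ∑ i ∈ Finset.range N,
      (-1) ^ i / (2 * (i : ℝ) + 1) * (1 - Real.cos ((2 * (i : ℝ) + 1) * x))) atTop (𝓝 0) := by
  have hc : ∀ y ∈ Set.uIcc 0 x, Real.cos y ≠ 0 := fun y hy => by
    rw [Set.uIcc_of_le h0] at hy
    exact (Real.cos_pos_of_mem_Ioo
      ⟨by linarith [Real.pi_pos, hy.1], by linarith [hy.2]⟩).ne'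
  have hg : IntervalIntegrable (fun y => 1 / (2 * Real.cos y)) MeasureTheory.volume 0 x :=
    ContinuousOn.intervalIntegrable (ContinuousOn.div (by fun_prop) (by fun_prop)
      fun y hy => mul_ne_zero two_ne_zero (hc y hy))
  have h := (tendsto_integral_mul_cos_sin_two_mul h0 hg).2
  rw [tendsto_zero_iff_abs_tendsto_zero] at h ⊢
  refine h.congr fun N => ?_
  have h2 := intervalIntegral.integral_eq_sub_of_hasDerivAt (a := 0) (b := x)
    (fun y _ => hasDerivAt_sum_alternating_one_sub_cos y N)
    (Continuous.intervalIntegrable (by fun_prop) _ _)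
  have h3 : ∫ y in (0 : ℝ)..x, ∑ i ∈ Finset.range N, (-1) ^ i * Real.sin ((2 * (i : ℝ) + 1) * y) =
      ∫ y in (0 : ℝ)..x, -(-1) ^ N * (1 / (2 * Real.cos y) * Real.sin (2 * N * y)) :=
    intervalIntegral.integral_congr fun y hy => sum_alternating_sin_eq_div (hc y hy) N
  rw [h3, intervalIntegral.integral_const_mul] at h2
  have h4 := congrArg abs h2
  rw [abs_mul, abs_neg, abs_pow, abs_neg, abs_one, one_pow, one_mul] at h4
  simpa [Function.comp_def] using h4

theorem seriesIn_alternating_mul_sum_one_div_odd :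
    SeriesIn fun i => (-1) ^ i / (2 * (i : ℝ) + 1) *
      ∑ j ∈ Finset.range i, 1 / (2 * (j : ℝ) + 1) := by
  have hpi := Real.pi_div_two_pos.le
  refine SeriesIn.of_two_mul_add (f := fun i => (-1) ^ i / (2 * (i : ℝ) + 1))
    (g := fun i => 1 / (2 * (i : ℝ) + 1)) ?_ ?_
  · refine (seriesIn_neg_one_pow_div_odd_pow le_rfl).congr fun i => ?_
    field_simp
  set D : ℕ → ℝ → ℝ := fun N x => ∑ i ∈ Finset.range N,
    (-1) ^ i / (2 * (i : ℝ) + 1) * (1 - Real.cos ((2 * (i : ℝ) + 1) * x)) with hD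
  have hmeas : ∀ N, Measurable fun x => D N x * (Real.cos x / Real.sin x) := fun N => by
    simp only [hD]
    fun_prop
  have hbound : ∀ N x, 0 < x → x ≤ Real.pi / 2 →
      |D N x * (Real.cos x / Real.sin x)| ≤ Real.pi / 2 := by
    intro N x h0 h1
    rcases h1.eq_or_lt with rfl | h1'
    · rw [Real.cos_pi_div_two, zero_div, mul_zero, abs_zero]
      exact hpi
    have hs := sin_pos_of_mem_Ioc h0 h1
    have hc : 0 < Real.cos x := Real.cos_pos_of_mem_Ioo ⟨by linarith [Real.pi_pos], h1'⟩
    rw [abs_mul, abs_of_pos (div_pos hc hs)]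
    calc _ ≤ 1 / (2 * Real.cos x) * x * (Real.cos x / Real.sin x) := by
          gcongr
          exact abs_sum_alternating_one_sub_cos_le h0.le h1' N
      _ = x / Real.sin x / 2 := by field_simp
      _ ≤ Real.pi / 2 := by
          have h := div_sin_le h0 h1
          linarith
  have hlim : Tendsto (fun N => ∫ x in (0 : ℝ)..(Real.pi / 2), D N x * (Real.cos x / Real.sin x))
      atTop (𝓝 (∫ x in (0 : ℝ)..(Real.pi / 2), 0)) := by
    refine intervalIntegral.tendsto_integral_filter_of_dominated_convergence (fun _ => Real.pi / 2)
      (Eventually.of_forall fun N => (hmeas N).aestronglyMeasurable)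
      (Eventually.of_forall fun N => Eventually.of_forall fun x hx => ?_) (by simp)
      (Eventually.of_forall fun x hx => ?_) <;> rw [Set.uIoc_of_le hpi] at hx
    · exact hbound N x hx.1 hx.2
    · rcases hx.2.eq_or_lt with rfl | h1
      · simp
      · simpa using (tendsto_sum_alternating_one_sub_cos hx.1.le h1).mul_const
          (Real.cos x / Real.sin x)
  rw [intervalIntegral.integral_zero] at hlim
  -- Since `1 - cos x cos(ax) = (1 - cos x) + cos x (1 - cos(ax))`, each partial sum is a Leibniz
  -- partial sum times `log 2`, plus `∫ D N x cot x`, which tends to `0`.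
  refine ⟨Real.pi / 4 * Real.log 2 + 0, ?_,
    ((Real.tendsto_sum_pi_div_four.mul_const (Real.log 2)).add hlim).congr fun N => ?_⟩
  · rw [add_zero]
    exact mul_mem (by simpa using div_natCast_mem_parityRing pi_mem_parityRing 4)
      log_two_mem_parityRing
  · have i1 : ∀ i ∈ Finset.range N, IntervalIntegrable (fun x => (-1) ^ i / (2 * (i : ℝ) + 1) *
        ((1 - Real.cos x * Real.cos ((2 * (i : ℝ) + 1) * x)) / Real.sin x))
        MeasureTheory.volume 0 (Real.pi / 2) :=
      fun i _ => (intervalIntegrable_one_sub_cos_mul_cos_odd_div_sin i).const_mul _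
    simp_rw [← integral_one_sub_cos_mul_cos_odd_div_sin, ← intervalIntegral.integral_const_mul]
    rw [← intervalIntegral.integral_finsetSum i1, ← integral_one_sub_cos_div_sin,
      ← intervalIntegral.integral_const_mul, ← intervalIntegral.integral_add
        (intervalIntegrable_one_sub_cos_div_sin.const_mul _)
        (intervalIntegrable_of_bounded_Ioc hpi (hmeas N) (hbound N))]
    refine intervalIntegral.integral_congr fun x _ => ?_
    simp only [hD, Finset.sum_mul, ← Finset.sum_add_distrib]
    refine Finset.sum_congr rfl fun i _ => ?_
    ring

/-! ### Exchanging the two summation indices -/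

theorem sum_mul_sum_eq_add (f g : ℕ → ℝ) (N : ℕ) :
    (∑ i ∈ Finset.range N, f i) * ∑ i ∈ Finset.range N, g i =
      (∑ i ∈ Finset.range N, f i * ∑ j ∈ Finset.range i, g j) +
        (∑ i ∈ Finset.range N, g i * ∑ j ∈ Finset.range i, f j) +
          ∑ i ∈ Finset.range N, f i * g i := by
  induction N with
  | zero => simp
  | succ N ih =>
    simp only [Finset.sum_range_succ _ N]
    linear_combination ih

theorem SeriesIn.mul_sum_symm {f g : ℕ → ℝ} (hf : SeriesIn f) (hg : SeriesIn g)
    (hd : SeriesIn fun i => f i * g i) (h : SeriesIn fun i => g i * ∑ j ∈ Finset.range i, f j) :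
    SeriesIn fun i => f i * ∑ j ∈ Finset.range i, g j := by
  obtain ⟨F, hF, hf⟩ := hf
  obtain ⟨G, hG, hg⟩ := hg
  obtain ⟨E, hE, hd⟩ := hd
  obtain ⟨L, hL, h⟩ := h
  refine ⟨F * G - L - E, sub_mem (sub_mem (mul_mem hF hG) hL) hE,
    (((hf.mul hg).sub h).sub hd).congr fun N => ?_⟩
  rw [sum_mul_sum_eq_add]
  ring

/-! ### Parity classes and the case distinction -/

/-- The general term of the single `t`-series, indexed from `0` and without its leading sign. -/
noncomputable def tTerm (s : ℝ) (p i : ℕ) : ℝ := s ^ i / (2 * (i : ℝ) + 1) ^ p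

/-- The term `(n, s, p) ↦ sⁿ / (2n - 1)ᵖ`, over all integers `n`, is even in `2n - 1` up to sign. -/
def EvenSign (s : ℝ) (p : ℕ) : Prop := (s = 1 ∧ Even p) ∨ (s = -1 ∧ Odd p)

/-- The term `(n, s, p) ↦ sⁿ / (2n - 1)ᵖ`, over all integers `n`, is odd in `2n - 1` up to sign. -/
def OddSign (s : ℝ) (p : ℕ) : Prop := (s = 1 ∧ Odd p) ∨ (s = -1 ∧ Even p)

theorem OddSign.seriesIn {s : ℝ} {p : ℕ} (h : OddSign s p) (hp : 2 ≤ p) :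
    SeriesIn (tTerm s p) := by
  rcases h with ⟨rfl, k, rfl⟩ | ⟨rfl, k, rfl⟩
  · exact (seriesIn_one_div_odd_pow (k := k) (by lia)).congr fun i => by rw [tTerm, one_pow]
  · exact (seriesIn_neg_one_pow_div_odd_pow (k := k) (by lia)).congr fun i => by
      rw [tTerm, two_mul k]

theorem OddSign.exists_hasSum_sin {s : ℝ} {p : ℕ} (h : OddSign s p) (hp : 2 ≤ p) :
    ∃ P : Polynomial parityRing, ∀ x ∈ Set.Icc 0 (Real.pi / 2),
      HasSum (fun i : ℕ => tTerm s p i * Real.sin ((2 * (i : ℝ) + 1) * x))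
        (Polynomial.aeval x P) := by
  rcases h with ⟨rfl, k, rfl⟩ | ⟨rfl, k, rfl⟩
  · obtain ⟨P, hP⟩ := _root_.exists_hasSum_sin (k := k) (by lia)
    exact ⟨P, fun x hx => (hP x hx).congr_fun fun i => by rw [tTerm, one_pow, one_div_mul_eq_div]⟩
  · obtain ⟨P, hP⟩ := exists_hasSum_alternating_sin (k := k) (by lia)
    exact ⟨P, fun x hx => (hP x hx).congr_fun fun i => by rw [tTerm, two_mul k]⟩

theorem EvenSign.exists_hasSum_cos {s : ℝ} {p : ℕ} (h : EvenSign s p) (hp : 2 ≤ p) :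
    ∃ P : Polynomial parityRing, ∀ x ∈ Set.Icc 0 (Real.pi / 2),
      HasSum (fun i : ℕ => tTerm s p i * Real.cos ((2 * (i : ℝ) + 1) * x))
        (Polynomial.aeval x P) := by
  rcases h with ⟨rfl, k, rfl⟩ | ⟨rfl, k, rfl⟩
  · obtain ⟨P, hP⟩ := _root_.exists_hasSum_cos (k := k) (by lia)
    exact ⟨P, fun x hx => (hP x hx).congr_fun fun i => by
      rw [tTerm, one_pow, one_div_mul_eq_div, two_mul k]⟩
  · obtain ⟨P, hP⟩ := exists_hasSum_alternating_cos (k := k) (by lia)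
    exact ⟨P, fun x hx => (hP x hx).congr_fun fun i => by rw [tTerm]⟩

theorem EvenSign.eq_neg_one {s : ℝ} (h : EvenSign s 1) : s = -1 := by
  rcases h with ⟨_, h⟩ | ⟨h, _⟩
  · exact absurd h Nat.not_even_one
  · exact h

theorem EvenSign.seriesIn {s : ℝ} {p : ℕ} (h : EvenSign s p) (hp : 1 ≤ p) :
    SeriesIn (tTerm s p) := by
  rcases hp.eq_or_lt with rfl | hp
  · rw [h.eq_neg_one]
    refine ⟨Real.pi / 4, by simpa using div_natCast_mem_parityRing pi_mem_parityRing 4, ?_⟩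
    simpa [tTerm] using Real.tendsto_sum_pi_div_four
  · obtain ⟨P, hP⟩ := h.exists_hasSum_cos hp
    refine (hP 0 ⟨le_rfl, Real.pi_div_two_pos.le⟩).seriesIn
      (aeval_mem_parityRing P (zero_mem _)) |>.congr fun i => ?_
    rw [mul_zero, Real.cos_zero, mul_one]

theorem EvenSign.exists_cos_moments {s : ℝ} {p : ℕ} (h : EvenSign s p) (hp : 1 ≤ p) :
    ∃ P : Polynomial parityRing, ∀ i : ℕ, ∫ x in (0 : ℝ)..(Real.pi / 2),
      Polynomial.aeval x P * Real.cos ((2 * (i : ℝ) + 1) * x) = tTerm s p i := by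
  rcases h with ⟨rfl, k, rfl⟩ | ⟨rfl, k, rfl⟩
  · obtain ⟨l, rfl⟩ : ∃ l, k = l + 1 := ⟨k - 1, by lia⟩
    obtain ⟨P, hP⟩ := exists_cos_moments_even l
    exact ⟨P, fun i => by rw [hP, tTerm, one_pow, two_mul (l + 1)]⟩
  · exact exists_cos_moments_odd k

theorem abs_tTerm_le {s : ℝ} (hs : |s| = 1) {p : ℕ} (hp : 2 ≤ p) (i : ℕ) :
    |tTerm s p i| ≤ 1 / (2 * (i : ℝ) + 1) ^ 2 := by
  have ha : (1 : ℝ) ≤ 2 * (i : ℝ) + 1 := by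
    have : (0 : ℝ) ≤ i := Nat.cast_nonneg i
    linarith
  rw [tTerm, abs_div, abs_pow, hs, one_pow, abs_of_pos (by positivity)]
  gcongr

theorem EvenSign.abs_eq_one {s : ℝ} {p : ℕ} (h : EvenSign s p) : |s| = 1 := by
  rcases h with ⟨rfl, _⟩ | ⟨rfl, _⟩ <;> simp

theorem OddSign.abs_eq_one {s : ℝ} {p : ℕ} (h : OddSign s p) : |s| = 1 := by
  rcases h with ⟨rfl, _⟩ | ⟨rfl, _⟩ <;> simp

theorem OddSign.mul_evenSign {s t : ℝ} {p q : ℕ} (hs : OddSign s p) (ht : EvenSign t q) :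
    OddSign (s * t) (p + q) := by
  rcases hs with ⟨rfl, hp⟩ | ⟨rfl, hp⟩ <;> rcases ht with ⟨rfl, hq⟩ | ⟨rfl, hq⟩
  · exact Or.inl ⟨by norm_num, hp.add_even hq⟩
  · exact Or.inr ⟨by norm_num, hp.add_odd hq⟩
  · exact Or.inr ⟨by norm_num, hp.add hq⟩
  · exact Or.inl ⟨by norm_num, hp.add_odd hq⟩

theorem tTerm_mul_tTerm (s t : ℝ) (p q i : ℕ) :
    tTerm s p i * tTerm t q i = tTerm (s * t) (p + q) i := by
  rw [tTerm, tTerm, tTerm, div_mul_div_comm, mul_pow, pow_add]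

theorem seriesIn_double_of_odd_of_even {s t : ℝ} {p q : ℕ} (hs : OddSign s p) (ht : EvenSign t q)
    (hp : 2 ≤ p) (hq : 1 ≤ q) :
    SeriesIn fun i => tTerm s p i * ∑ j ∈ Finset.range i, tTerm t q j :=
  seriesIn_mul_sum_of_cos_moments (abs_tTerm_le hs.abs_eq_one hp) (hs.exists_hasSum_sin hp)
    (ht.exists_cos_moments hq)
    (((hs.mul_evenSign ht).seriesIn (by lia)).congr (tTerm_mul_tTerm s t p q))

theorem seriesIn_double_of_even_of_odd {s t : ℝ} {p q : ℕ} (hs : EvenSign s p) (ht : OddSign t q)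
    (hp : 1 ≤ p) (hq : 1 ≤ q) :
    SeriesIn fun i => tTerm s p i * ∑ j ∈ Finset.range i, tTerm t q j := by
  have hd : SeriesIn fun i => tTerm s p i * tTerm t q i :=
    ((ht.mul_evenSign hs).seriesIn (by lia)).congr fun i => by
      rw [mul_comm, tTerm_mul_tTerm]
  rcases hq.eq_or_lt with rfl | hq
  · obtain rfl : t = 1 := by
      rcases ht with ⟨h, _⟩ | ⟨_, h⟩
      · exact h
      · exact absurd h Nat.not_even_one
    have e : ∀ j, tTerm 1 1 j = 1 / (2 * (j : ℝ) + 1) := fun j => by simp [tTerm]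
    simp only [e] at hd ⊢
    rcases hp.eq_or_lt with rfl | hp
    · rw [hs.eq_neg_one]
      exact seriesIn_alternating_mul_sum_one_div_odd.congr fun i => by simp [tTerm]
    · exact seriesIn_mul_sum_one_div_odd (abs_tTerm_le hs.abs_eq_one hp)
        (hs.exists_hasSum_cos hp) hd
  -- With `q ≥ 2` both single series converge, so their product reduces this order to the opposite
  -- one.
  · exact (hs.seriesIn hp).mul_sum_symm (ht.seriesIn hq) hd
      (seriesIn_double_of_odd_of_even ht hs hq hp)

/-! ### Back to the double `t`-values -/

theorem doubleTPartial_eq (p q : ℕ) (σ₁ σ₂ : ℤˣ) (N : ℕ) :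
    doubleTPartial p q σ₁ σ₂ N = (((σ₁ * σ₂ : ℤˣ) : ℤ) : ℝ) * ∑ i ∈ Finset.range N,
      tTerm ((σ₁ : ℤ) : ℝ) p i * ∑ j ∈ Finset.range i, tTerm ((σ₂ : ℤ) : ℝ) q j := by
  rw [doubleTPartial, show Finset.Icc 1 N = Finset.Ico 1 (N + 1) from rfl,
    Finset.sum_Ico_eq_sum_range, Nat.add_sub_cancel, Finset.mul_sum]
  refine Finset.sum_congr rfl fun i _ => ?_
  rw [Finset.sum_Ico_eq_sum_range, Nat.add_sub_cancel_left, Finset.mul_sum, Finset.mul_sum]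
  refine Finset.sum_congr rfl fun j _ => ?_
  rw [tTerm, tTerm]
  push_cast
  rw [show 2 * (1 + (i : ℝ)) - 1 = 2 * i + 1 by ring, show 2 * (1 + (j : ℝ)) - 1 = 2 * j + 1 by ring,
    pow_add, pow_add]
  ring

theorem doubleTTildePartial_eq (p q : ℕ) (σ₁ σ₂ : ℤˣ) (N : ℕ) :
    doubleTTildePartial p q σ₁ σ₂ N = 2 ^ (p + q) * doubleTPartial p q σ₁ σ₂ N := by
  rw [doubleTTildePartial, doubleTPartial, Finset.mul_sum]
  refine Finset.sum_congr rfl fun m _ => ?_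
  rw [Finset.mul_sum]
  refine Finset.sum_congr rfl fun n _ => ?_
  rw [show 2 * (m : ℝ) - 1 = 2 * (m - 1 / 2) by ring, show 2 * (n : ℝ) - 1 = 2 * (n - 1 / 2) by ring,
    mul_pow, mul_pow, mul_mul_mul_comm, ← pow_add, ← mul_div_assoc,
    mul_div_mul_left _ _ (by positivity)]

theorem seriesIn_double {p q : ℕ} (hp : 1 ≤ p) (hq : 1 ≤ q) {σ₁ σ₂ : ℤˣ}
    (hconv : ¬(p = 1 ∧ σ₁ = 1))
    (hparity : ((p : ℤ) + (q : ℤ)) ≡ (1 + (σ₁ : ℤ) * (σ₂ : ℤ)) / 2 [ZMOD 2]) :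
    SeriesIn fun i => tTerm ((σ₁ : ℤ) : ℝ) p i *
      ∑ j ∈ Finset.range i, tTerm ((σ₂ : ℤ) : ℝ) q j := by
  -- An odd class with `p = 1` would force `σ₁ = 1`, the excluded divergent case; hence `2 ≤ p` in
  -- the first alternative.
  have key : (OddSign ((σ₁ : ℤ) : ℝ) p ∧ EvenSign ((σ₂ : ℤ) : ℝ) q ∧ 2 ≤ p) ∨
      (EvenSign ((σ₁ : ℤ) : ℝ) p ∧ OddSign ((σ₂ : ℤ) : ℝ) q) := by
    unfold OddSign EvenSign
    rw [Int.ModEq] at hparity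
    rcases Int.units_eq_one_or σ₁ with rfl | rfl <;> rcases Int.units_eq_one_or σ₂ with rfl | rfl <;>
      norm_num at hparity hconv ⊢ <;> simp only [Nat.even_iff, Nat.odd_iff] <;> lia
  rcases key with ⟨h1, h2, h3⟩ | ⟨h1, h2⟩
  · exact seriesIn_double_of_odd_of_even h1 h2 h3 hq
  · exact seriesIn_double_of_even_of_odd h1 h2 hp hq

theorem mainTheorem6 (p q : ℕ) (hp : 1 ≤ p) (hq : 1 ≤ q) (σ₁ σ₂ : ℤˣ)
    (hconv : ¬(p = 1 ∧ σ₁ = 1))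
    (hparity : ((p : ℤ) + (q : ℤ)) ≡ (1 + (σ₁ : ℤ) * (σ₂ : ℤ)) / 2 [ZMOD 2]) :
    (Tendsto (doubleTPartial p q σ₁ σ₂) atTop (𝓝 (doubleT p q σ₁ σ₂)) ∧
      IsReducible (doubleT p q σ₁ σ₂)) ∧
    (Tendsto (doubleTTildePartial p q σ₁ σ₂) atTop (𝓝 (doubleTTilde p q σ₁ σ₂)) ∧
      IsReducible (doubleTTilde p q σ₁ σ₂)) := by
  obtain ⟨L, hL, h⟩ := seriesIn_double hp hq hconv hparity
  have h1 := (h.const_mul (((σ₁ * σ₂ : ℤˣ) : ℤ) : ℝ)).congr fun N =>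
    (doubleTPartial_eq p q σ₁ σ₂ N).symm
  have h2 := (h1.const_mul (2 ^ (p + q))).congr fun N =>
    (doubleTTildePartial_eq p q σ₁ σ₂ N).symm
  have m1 : (((σ₁ * σ₂ : ℤˣ) : ℤ) : ℝ) * L ∈ parityRing := mul_mem (intCast_mem _ _) hL
  have m2 := mul_mem (pow_mem (natCast_mem_parityRing 2) (p + q)) m1
  have e1 : doubleT p q σ₁ σ₂ = _ := h1.limUnder_eq
  have e2 : doubleTTilde p q σ₁ σ₂ = _ := h2.limUnder_eq
  rw [e1, e2]
  exact ⟨⟨h1, m1⟩, ⟨h2, m2⟩⟩
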